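/- Write $\mathrm{tw}_1(x)=x$ and $\mathrm{tw}_k(x)=2^{\mathrm{tw}_{k-1}(x)}$ for $k\ge 2$. For a $k$-uniform hypergraph $H$, let $r_k(H;4)$ be its $4$-color Ramsey number, i.e. the least integer $N$ such that every coloring of the edges of the complete $k$-uniform hypergraph on $N$ vertices with $4$ colors contains a monochromatic copy of $H$. **Theorem 1.3.** For every integer $k\ge 2$ there is a constant $c_k>0$ such that for every positive integer $m$ with $km>\mathrm{tw}_k(0)$ there is a $k$-uniform hypergraph $H$ with exactly $m$ edges and no isolated vertices such that $$r_k(H;4)\ \ge\ \mathrm{tw}_k\big(c_k\sqrt m\big).$$ (The condition $km>\mathrm{tw}_k(0)$ holds for all $m\ge 1$ if $k\le 3$, and for each $k\ge 4$ it excludes only finitely many $m$.) -/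

import Mathlib

/-- The tower function: `tw_1(x) = x` and `tw_k(x) = 2 ^ tw_{k-1}(x)` for `k ≥ 2`
(the value at `k = 0` is a dummy). -/
noncomputable def tower : ℕ → ℝ → ℝ
  | 0, x => x
  | 1, x => x
  | k + 2, x => (2 : ℝ) ^ tower (k + 1) x

/-- Every edge has exactly `k` vertices. -/
def Hypergraph.IsUniform {α : Type*} (H : Hypergraph α) (k : ℕ) : Prop :=
  ∀ e ∈ H.edgeSet, e.encard = k

/-- Every vertex lies in some edge. -/
def Hypergraph.NoIsolated {α : Type*} (H : Hypergraph α) : Prop :=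
  ∀ v ∈ H.vertexSet, ¬ H.IsIsolated v

/-- The complete `k`-uniform hypergraph `K_N^(k)` on the vertex set `Fin N`. -/
def completeUniform (k N : ℕ) : Hypergraph (Fin N) where
  vertexSet := Set.univ
  edgeSet := {e | e.encard = k}
  subset_vertexSet_of_mem_edgeSet' := fun e _ => Set.subset_univ e

/-- For an edge-colored hypergraph `Γ`, there is a monochromatic copy of `H` in `Γ`: an injection
of the vertices of `H` into those of `Γ` that maps all edges of `H` to edges of `Γ` of one and the
same color. -/
def Hypergraph.HasMonochromaticCopy {α β C : Type*} (H : Hypergraph α) (Γ : Hypergraph β)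
    (χ : Γ.edgeSet → C) : Prop :=
  ∃ f : H.vertexSet ↪ Γ.vertexSet, ∃ c : C, ∀ e ∈ H.edgeSet,
    ∃ h : {y : β | ∃ v : H.vertexSet, (v : α) ∈ e ∧ (f v : β) = y} ∈ Γ.edgeSet, χ ⟨_, h⟩ = c

/-- The `q`-color Ramsey number `r_k(H; q)`: the least `N` such that every `q`-coloring of the
edges of `K_N^(k)` contains a monochromatic copy of `H`. -/
noncomputable def Hypergraph.ramseyNumber {α : Type*} (H : Hypergraph α) (k q : ℕ) : ℕ :=
  sInf {N : ℕ | ∀ χ : (completeUniform k N).edgeSet → Fin q,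
    H.HasMonochromaticCopy (completeUniform k N) χ}

/-!
The hypergraph is a blow-up of a complete graph. Take `n` disjoint blocks of vertices whose size `b`
depends on `k` only; the edges are all `k`-sets inside the union of two blocks. There are at most
`n ^ 2 * 4 ^ b` of them, so `n` may be of order `√m`, and further edges are added to reach exactly
`m`. What has to be shown is that the `k`-subsets of `tw_k(a)` points, with `a` of order `n`, have a
`4`-coloring without a monochromatic copy of this structure (`exists_hasBlockColoring`).

For `k = 2` and `b = 1` this is the bound of Erdős for complete graphs, with two colors
(`hasBlockColoring_pairs`). To pass from `k` to `k + 1`, the points are taken to be the leaves of a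
binary tree whose levels are the points of the previous ground set. A set of `k + 1` leaves is a
*comb* if all its elements but one, its end, lie on one side of the end and leave the path to it at
distinct heights. The old coloring is applied to the `k` heights at which a comb branches.

* From pairs to triples (`HasBlockColoring.step_pairs`), every triple is a comb on exactly one side,
  and the two remaining bits of the color record which. If all triples in the union of two pairs are
  combs on the same side, then the heights at which these pairs branch are the two branchings of one
  of the triples (`exists_triple_of_pairs`). So `n` monochromatic pairs of leaves yield a
  monochromatic complete graph on their `n` heights.
* For `k ≥ 3` (`HasBlockColoring.step`), the sets that are not combs get color `1` or `0`, according
  to whether their highest branching splits off a single leaf. A large block contains a long comb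
  (`exists_isCombSeq`), and half of these combs have their ends on the same side. Either two such
  combs lie, in their low parts, in different subtrees, or the heights of their middle parts can be
  read off along one common path. In the first case, and in the second if a height occurs twice,
  there are sets of both colors `0` and `1` in the union of the blocks (`clashes_of_apart`,
  `clashes_of_same_height`). Hence the middle heights of the combs form a monochromatic family of
  blocks one level down (`merges_of_not_clashes`). Each step halves the number of blocks, which only
  affects the constant.

It is essential that the conclusion about two blocks uses only edges in their union, and that the
part of a block that is kept does not depend on the other block.

The finitely many `m` that are too small for a block structure are settled by a perfect matching:
it has `k * m` vertices, which exceeds `tw_k(0)`, hence also `tw_k(c * √m)` for small `c`. Finally,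
the finite Ramsey theorem (`exists_forall_monochromatic_subset`) shows that the Ramsey number is
the minimum of a nonempty set, so that a lower bound for all its elements is one for the number.
-/

/-! ### Heights in the binary tree -/

theorem exists_div_two_pow_eq (x y : ℕ) : ∃ d, x / 2 ^ d = y / 2 ^ d := by
  refine ⟨x + y, ?_⟩
  have h : x + y < 2 ^ (x + y) := Nat.lt_two_pow_self
  rw [Nat.div_eq_of_lt (by omega), Nat.div_eq_of_lt (by omega)]

/-- The height of the lowest common ancestor of the leaves `x` and `y` of the infinite binary tree
whose leaves are the natural numbers, the ancestor of `x` at height `d` being `x / 2 ^ d`. So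
`sep x y` is one more than the position of the highest binary digit where `x` and `y` differ, and
`0` if `x = y`. -/
def sep (x y : ℕ) : ℕ := Nat.find (exists_div_two_pow_eq x y)

theorem sep_le_iff {x y d : ℕ} : sep x y ≤ d ↔ x / 2 ^ d = y / 2 ^ d := by
  constructor
  · intro h
    have h1 : x / 2 ^ sep x y = y / 2 ^ sep x y := Nat.find_spec (exists_div_two_pow_eq x y)
    obtain ⟨t, rfl⟩ := Nat.exists_eq_add_of_le h
    rw [pow_add, ← Nat.div_div_eq_div_mul, ← Nat.div_div_eq_div_mul, h1]
  · exact fun h => Nat.find_min' _ h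

theorem sep_comm (x y : ℕ) : sep x y = sep y x :=
  le_antisymm (sep_le_iff.2 (sep_le_iff.1 le_rfl).symm) (sep_le_iff.2 (sep_le_iff.1 le_rfl).symm)

theorem sep_eq_zero {x y : ℕ} : sep x y = 0 ↔ x = y := by
  rw [← Nat.le_zero, sep_le_iff]; simp

theorem sep_pos {x y : ℕ} (h : x ≠ y) : 0 < sep x y :=
  Nat.pos_of_ne_zero fun h' => h (sep_eq_zero.1 h')

theorem sep_self (x : ℕ) : sep x x = 0 := sep_eq_zero.2 rfl

theorem sep_le_of_lt_two_pow {x y N : ℕ} (hx : x < 2 ^ N) (hy : y < 2 ^ N) : sep x y ≤ N := by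
  rw [sep_le_iff, Nat.div_eq_of_lt hx, Nat.div_eq_of_lt hy]

theorem sep_le_of_le {x y z d : ℕ} (hx : sep x z ≤ d) (hy : sep y z ≤ d) : sep x y ≤ d := by
  rw [sep_le_iff] at *; rw [hx, hy]

theorem sep_lt_of_lt {x y z d : ℕ} (hx : sep x z < d) (hy : sep y z < d) : sep x y < d := by
  have := sep_le_of_le (d := d - 1) (x := x) (y := y) (z := z) (by omega) (by omega)
  omega

theorem sep_eq_of_lt {x y z : ℕ} (h : sep y z < sep x z) : sep x y = sep x z := by
  apply le_antisymm
  · exact sep_le_of_le le_rfl h.le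
  · by_contra! h'
    exact lt_irrefl _ (sep_lt_of_lt (z := y) h' (by rwa [sep_comm z y]))

/-- The tree is binary: two leaves that leave the path to `z` at the same height leave it into the
same subtree. -/
theorem sep_lt_of_eq {x y z : ℕ} (hz : x ≠ z) (h : sep x z = sep y z) : sep x y < sep x z := by
  obtain ⟨d, hd⟩ := Nat.exists_eq_succ_of_ne_zero (sep_pos hz).ne'
  have hx : ¬ sep x z ≤ d := by omega
  have hy : ¬ sep y z ≤ d := by omega
  have hx' : sep x z ≤ d + 1 := by omega
  have hy' : sep y z ≤ d + 1 := by omega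
  suffices sep x y ≤ d by omega
  rw [sep_le_iff] at *
  rw [pow_succ, ← Nat.div_div_eq_div_mul, ← Nat.div_div_eq_div_mul] at hx' hy'
  omega

theorem lt_iff_lt_of_sep_lt {a b c : ℕ} (h : sep b c < sep a c) : a < b ↔ a < c := by
  have h1 : sep b c ≤ sep b c := le_rfl
  have h2 : ¬ sep a c ≤ sep b c := by omega
  rw [sep_le_iff] at h1 h2
  have h3 : ∀ x y : ℕ, x / 2 ^ sep b c ≠ y / 2 ^ sep b c →
      (x < y ↔ x / 2 ^ sep b c < y / 2 ^ sep b c) := fun x y hne =>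
    ⟨fun hxy => lt_of_le_of_ne (Nat.div_le_div_right hxy.le) hne, fun hxy => by
      by_contra! h4
      exact absurd (Nat.div_le_div_right (c := 2 ^ sep b c) h4) (by omega)⟩
  rw [h3 a b (by rwa [h1]), h3 a c h2, h1]

/-- A linear order of the leaves in which disjoint subtrees do not interlace. The two orders that
matter are `<` and `>`; the notion lets both be treated at once. -/
structure IsTreeOrder (r : ℕ → ℕ → Prop) : Prop where
  asymm : ∀ {a b}, r a b → ¬ r b a
  trans : ∀ {a b c}, r a b → r b c → r a c
  total : ∀ {a b}, a ≠ b → r a b ∨ r b a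
  congr : ∀ {a b c}, sep b c < sep a c → (r a b ↔ r a c)

theorem IsTreeOrder.ne {r : ℕ → ℕ → Prop} (hr : IsTreeOrder r) {a b : ℕ} (h : r a b) : a ≠ b := by
  rintro rfl; exact hr.asymm h h

theorem isTreeOrder_lt : IsTreeOrder (· < ·) :=
  ⟨fun h => by omega, fun h h' => by omega, fun h => by omega, lt_iff_lt_of_sep_lt⟩

theorem IsTreeOrder.flip {r : ℕ → ℕ → Prop} (hr : IsTreeOrder r) : IsTreeOrder (flip r) where
  asymm h := hr.asymm h
  trans h h' := hr.trans h' h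
  total h := (hr.total h).symm
  congr {a b c} h := by
    have h1 := hr.congr h
    have h2 : a ≠ b := by rintro rfl; omega
    have h3 : a ≠ c := by rintro rfl; rw [sep_self] at h; omega
    have h4 := @hr.asymm a b
    have h5 := @hr.asymm a c
    have h6 := hr.total h2
    have h7 := hr.total h3
    unfold _root_.flip
    tauto

/-! ### Combs -/

/-- `e` is a comb with end `α`: every other element of `e` lies on the same side of `α` (the lower
one for `r`), and they leave the path to `α` at distinct heights. -/
def IsCombAt (r : ℕ → ℕ → Prop) (e : Finset ℕ) (α : ℕ) : Prop :=
  α ∈ e ∧ (∀ a ∈ e, a ≠ α → r a α) ∧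
    ∀ a ∈ e, ∀ b ∈ e, a ≠ α → b ≠ α → sep a α = sep b α → a = b

/-- `e` is a comb with some end. -/
def IsComb (r : ℕ → ℕ → Prop) (e : Finset ℕ) : Prop := ∃ α, IsCombAt r e α

/-- The heights of the branchings of `e`, counted from `0`. -/
def branchings (e : Finset ℕ) : Finset ℕ := e.offDiag.image fun p => sep p.1 p.2 - 1

theorem IsCombAt.branchings_eq {r : ℕ → ℕ → Prop} {e : Finset ℕ} {α : ℕ} (h : IsCombAt r e α) :
    branchings e = (e.erase α).image fun a => sep a α - 1 := by
  obtain ⟨hα, -, hinj⟩ := h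
  ext d
  simp only [branchings, Finset.mem_image, Finset.mem_offDiag, Prod.exists, Finset.mem_erase]
  constructor
  · rintro ⟨x, y, ⟨hx, hy, hxy⟩, rfl⟩
    by_cases h1 : y = α
    · subst h1; exact ⟨x, ⟨hxy, hx⟩, rfl⟩
    by_cases h2 : x = α
    · subst h2; exact ⟨y, ⟨h1, hy⟩, by rw [sep_comm]⟩
    rcases lt_trichotomy (sep x α) (sep y α) with h3 | h3 | h3
    · exact ⟨y, ⟨h1, hy⟩, by rw [sep_comm x y, sep_eq_of_lt h3]⟩
    · exact absurd (hinj x hx y hy h2 h1 h3) hxy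
    · exact ⟨x, ⟨h2, hx⟩, by rw [sep_eq_of_lt h3]⟩
  · rintro ⟨a, ⟨ha, hae⟩, rfl⟩
    exact ⟨a, α, ⟨hae, hα, ha⟩, rfl⟩

/-- One of the two parts into which `e` splits at its highest branching is a single point. -/
def HasIsolatedLeaf (e : Finset ℕ) : Prop :=
  ∃ x ∈ e, ∀ y ∈ e, ∀ z ∈ e, y ≠ x → z ≠ x → sep y z < sep x y

theorem IsCombAt.hasIsolatedLeaf {r : ℕ → ℕ → Prop} {e : Finset ℕ} {α : ℕ} (h : IsCombAt r e α)
    (he : 2 ≤ e.card) : HasIsolatedLeaf e := by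
  obtain ⟨hα, -, hinj⟩ := h
  have hne : (e.erase α).Nonempty := by
    rw [← Finset.card_pos, Finset.card_erase_of_mem hα]; omega
  obtain ⟨x, hx, hmax⟩ := Finset.exists_max_image _ (fun a => sep a α) hne
  rw [Finset.mem_erase] at hx
  have key : ∀ y ∈ e, y ≠ x → sep y α < sep x α := by
    intro y hy hyx
    by_cases hyα : y = α
    · rw [hyα, sep_self]; exact sep_pos hx.1
    · exact lt_of_le_of_ne (hmax y (Finset.mem_erase.2 ⟨hyα, hy⟩))
        fun h' => hyx (hinj y hy x hx.2 hyα hx.1 h')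
  refine ⟨x, hx.2, fun y hy z hz hyx hzx => ?_⟩
  rw [sep_eq_of_lt (key y hy hyx)]
  exact sep_lt_of_lt (key y hy hyx) (key z hz hzx)

theorem not_hasIsolatedLeaf_union {L R : Finset ℕ} {d : ℕ} (hL : 2 ≤ L.card) (hR : 2 ≤ R.card)
    (hLL : ∀ x ∈ L, ∀ y ∈ L, sep x y < d) (hRR : ∀ x ∈ R, ∀ y ∈ R, sep x y < d)
    (hLR : ∀ x ∈ L, ∀ y ∈ R, sep x y = d) : ¬ HasIsolatedLeaf (L ∪ R) := by
  have key : ∀ L R : Finset ℕ, 2 ≤ L.card → 2 ≤ R.card → (∀ x ∈ L, ∀ y ∈ L, sep x y < d) →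
      (∀ x ∈ L, ∀ y ∈ R, sep x y = d) → ∀ x ∈ L,
      ¬ ∀ y ∈ L ∪ R, ∀ z ∈ L ∪ R, y ≠ x → z ≠ x → sep y z < sep x y := by
    intro L R hL hR hLL hLR x hx h
    obtain ⟨y, hy, hyx⟩ := Finset.exists_mem_ne (by omega : 1 < L.card) x
    obtain ⟨z, hz⟩ := Finset.card_pos.1 (by omega : 0 < R.card)
    have h1 := h y (Finset.mem_union_left _ hy) z (Finset.mem_union_right _ hz) hyx (by
      rintro rfl
      have := hLL z hx z hx
      rw [hLR z hx z hz] at this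
      omega)
    rw [hLR y hy z hz] at h1
    have := hLL x hx y hy
    omega
  rintro ⟨x, hx, h⟩
  rcases Finset.mem_union.1 hx with hx | hx
  · exact key L R hL hR hLL hLR x hx h
  · rw [Finset.union_comm] at h
    exact key R L hR hL hRR (fun x hx y hy => by rw [sep_comm, hLR y hy x hx]) x hx h

/-- Every set of `2 ^ m` leaves has an element `α` such that the others leave the path to `α` at
`m` or more distinct heights. -/
theorem exists_many_heights (m : ℕ) : ∀ X : Finset ℕ, 2 ^ m ≤ X.card →
    ∃ α ∈ X, m ≤ ((X.erase α).image fun x => sep x α).card := by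
  induction m with
  | zero =>
    intro X hX
    obtain ⟨α, hα⟩ := Finset.card_pos.1 (by simpa using hX : 0 < X.card)
    exact ⟨α, hα, Nat.zero_le _⟩
  | succ m ih =>
    intro X hX
    rw [pow_succ] at hX
    have hpos : 0 < 2 ^ m := by positivity
    have hne : X.offDiag.Nonempty := by
      obtain ⟨x, hx, y, hy, hxy⟩ := Finset.one_lt_card.1 (by omega : 1 < X.card)
      exact ⟨(x, y), Finset.mem_offDiag.2 ⟨hx, hy, hxy⟩⟩
    obtain ⟨⟨p, q⟩, hpq, hmax⟩ := Finset.exists_max_image _ (fun p => sep p.1 p.2) hne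
    rw [Finset.mem_offDiag] at hpq
    obtain ⟨hp, hq, hpq⟩ := hpq
    simp only at hp hq hpq hmax
    set d := sep p q with hd
    have hdpos : 0 < d := sep_pos hpq
    have hle : ∀ x ∈ X, ∀ y ∈ X, sep x y ≤ d := by
      intro x hx y hy
      by_cases hxy : x = y
      · rw [hxy, sep_self]; omega
      · exact hmax (x, y) (Finset.mem_offDiag.2 ⟨hx, hy, hxy⟩)
    -- the leaves on the side of `p` of the highest branching
    have hcard := Finset.card_filter_add_card_filter_not (s := X) (fun x => sep x p < d)
    have hpos' : ∀ Y ⊆ X, (∀ x ∈ Y, ∀ y ∈ Y, sep x y < d) →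
        (∃ z ∈ X, ∀ x ∈ Y, sep z x = d) → 2 ^ m ≤ Y.card →
        ∃ α ∈ X, m + 1 ≤ ((X.erase α).image fun x => sep x α).card := by
      intro Y hYX hY ⟨z, hz, hzY⟩ hYc
      obtain ⟨α, hα, hm⟩ := ih Y hYc
      refine ⟨α, hYX hα, ?_⟩
      have h1 : d ∉ (Y.erase α).image fun x => sep x α := by
        intro h
        obtain ⟨x, hx, hxd⟩ := Finset.mem_image.1 h
        have := hY x (Finset.mem_of_mem_erase hx) α hα
        omega
      have h2 : insert d ((Y.erase α).image fun x => sep x α) ⊆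
          (X.erase α).image fun x => sep x α := by
        apply Finset.insert_subset
        · refine Finset.mem_image.2 ⟨z, Finset.mem_erase.2 ⟨?_, hz⟩, hzY α hα⟩
          rintro rfl
          have := hzY z hα
          rw [sep_self] at this
          omega
        · exact Finset.image_subset_image (Finset.erase_subset_erase _ hYX)
      have h3 := Finset.card_le_card h2
      rw [Finset.card_insert_of_notMem h1] at h3
      omega
    by_cases hbig : 2 ^ m ≤ (X.filter fun x => sep x p < d).card
    · refine hpos' _ (Finset.filter_subset _ _) ?_ ⟨q, hq, ?_⟩ hbig
      · intro x hx y hy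
        exact sep_lt_of_lt (Finset.mem_filter.1 hx).2 (Finset.mem_filter.1 hy).2
      · intro x hx
        have := (Finset.mem_filter.1 hx).2
        rw [hd, sep_comm p q] at this ⊢
        exact sep_eq_of_lt this
    · have hfar : ∀ x ∈ X.filter (fun x => ¬ sep x p < d), sep x p = d := fun x hx =>
        le_antisymm (hle x (Finset.mem_filter.1 hx).1 p hp)
          (not_lt.1 (Finset.mem_filter.1 hx).2)
      refine hpos' (X.filter fun x => ¬ sep x p < d) (Finset.filter_subset _ _) ?_
        ⟨p, hp, fun x hx => by rw [sep_comm]; exact hfar x hx⟩ (by omega)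
      intro x hx y hy
      have h1 := hfar x hx
      have h2 := hfar y hy
      rw [← h1]
      refine sep_lt_of_eq ?_ (h1.trans h2.symm)
      rintro rfl
      rw [sep_self] at h1
      omega

/-- A long comb in `B` with end `α`, its elements listed by increasing height at which they leave
the path to `α`. Only the first `s` terms of `f` are meaningful. -/
structure IsCombSeq (r : ℕ → ℕ → Prop) (s : ℕ) (B : Finset ℕ) (α : ℕ) (f : ℕ → ℕ) : Prop where
  end_mem : α ∈ B
  mem : ∀ p < s, f p ∈ B
  rel : ∀ p < s, r (f p) α
  lt : ∀ p q, p < q → q < s → sep (f p) α < sep (f q) α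

theorem exists_isCombSeq_of_card {r : ℕ → ℕ → Prop} {s : ℕ} {B C : Finset ℕ} {α : ℕ}
    (hα : α ∈ B) (hC : C ⊆ B) (hr : ∀ a ∈ C, r a α) (hs : s ≤ (C.image fun x => sep x α).card) :
    ∃ f, IsCombSeq r s B α f := by
  set D := C.image fun x => sep x α
  have hmem : ∀ p : Fin D.card, ∃ a ∈ C, sep a α = D.orderEmbOfFin rfl p := fun p =>
    Finset.mem_image.1 (D.orderEmbOfFin_mem rfl p)
  choose g hgC hg using hmem
  refine ⟨fun p => if h : p < D.card then g ⟨p, h⟩ else 0, hα, fun p hp => ?_, fun p hp => ?_,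
    fun p q hpq hq => ?_⟩
  · rw [dif_pos (by omega)]; exact hC (hgC _)
  · rw [dif_pos (by omega)]; exact hr _ (hgC _)
  · rw [dif_pos (by omega), dif_pos (by omega), hg, hg]
    exact (D.orderEmbOfFin rfl).strictMono (by simpa using hpq)

theorem exists_isCombSeq {s : ℕ} {B : Finset ℕ} (hB : 2 ^ (2 * s) ≤ B.card) :
    ∃ α f, IsCombSeq (· < ·) s B α f ∨ IsCombSeq (flip (· < ·)) s B α f := by
  obtain ⟨α, hα, h⟩ := exists_many_heights _ B hB
  have hsplit : B.erase α = (B.filter (· < α)) ∪ (B.filter (α < ·)) := by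
    ext x
    simp only [Finset.mem_erase, Finset.mem_union, Finset.mem_filter]
    constructor
    · rintro ⟨h1, h2⟩
      rcases lt_or_gt_of_ne h1 with h3 | h3
      · exact Or.inl ⟨h2, h3⟩
      · exact Or.inr ⟨h2, h3⟩
    · rintro (⟨h1, h2⟩ | ⟨h1, h2⟩)
      · exact ⟨h2.ne, h1⟩
      · exact ⟨h2.ne', h1⟩
  rw [hsplit, Finset.image_union] at h
  have hc := h.trans (Finset.card_union_le _ _)
  rcases le_or_gt s ((B.filter (· < α)).image fun x => sep x α).card with h1 | h1
  · obtain ⟨f, hf⟩ := exists_isCombSeq_of_card (r := (· < ·)) hα (Finset.filter_subset _ _)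
      (fun a ha => (Finset.mem_filter.1 ha).2) h1
    exact ⟨α, f, Or.inl hf⟩
  · obtain ⟨f, hf⟩ := exists_isCombSeq_of_card (r := flip (· < ·)) (s := s)
      (C := B.filter (α < ·)) hα (Finset.filter_subset _ _)
      (fun a ha => (Finset.mem_filter.1 ha).2) (by omega)
    exact ⟨α, f, Or.inr hf⟩

/-! ### Two interacting combs -/

section Combs

variable {r : ℕ → ℕ → Prop} {s : ℕ} {B B' : Finset ℕ} {α α' : ℕ} {f f' : ℕ → ℕ}

theorem IsCombSeq.sep_le (h : IsCombSeq r s B α f) {p q : ℕ} (hpq : p ≤ q) (hq : q < s) :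
    sep (f p) α ≤ sep (f q) α := by
  rcases hpq.eq_or_lt with rfl | h'
  · exact le_rfl
  · exact (h.lt p q h' hq).le

theorem IsCombSeq.injOn (h : IsCombSeq r s B α f) {m : ℕ} (hm : m ≤ s) :
    Set.InjOn f (Finset.range m) := by
  intro p hp q hq hpq
  simp only [Finset.coe_range, Set.mem_Iio] at hp hq
  by_contra hne
  rcases lt_or_gt_of_ne hne with h1 | h1
  · have := h.lt p q h1 (by omega); rw [hpq] at this; omega
  · have := h.lt q p h1 (by omega); rw [hpq] at this; omega

theorem IsCombSeq.card_image (h : IsCombSeq r s B α f) {m : ℕ} (hm : m ≤ s) :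
    ((Finset.range m).image f).card = m := by
  rw [Finset.card_image_of_injOn (h.injOn hm), Finset.card_range]

theorem IsCombSeq.image_subset (h : IsCombSeq r s B α f) {m : ℕ} (hm : m ≤ s) :
    (Finset.range m).image f ⊆ B := by
  intro x hx
  obtain ⟨p, hp, rfl⟩ := Finset.mem_image.1 hx
  exact h.mem p (by have := Finset.mem_range.1 hp; omega)

/-- Among the `K`-subsets of `U` there are both one that is not a comb but has an isolated leaf and
one that has no isolated leaf. The stepping-up coloring gives these two sets different colors. -/
def Clashes (r : ℕ → ℕ → Prop) (K : ℕ) (U : Finset ℕ) : Prop :=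
  (∃ e ⊆ U, e.card = K ∧ HasIsolatedLeaf e ∧ ¬ IsComb r e ∧ ¬ IsComb (flip r) e) ∧
    ∃ e ⊆ U, e.card = K ∧ ¬ HasIsolatedLeaf e

theorem clashes_of_apart_of_rel (hr : IsTreeOrder r) {K : ℕ} (hK : 4 ≤ K) (hs : K < s)
    (h : IsCombSeq r s B α f) (h' : IsCombSeq r s B' α' f')
    (hα : sep (f K) α ≤ sep α α') (hα' : sep (f' K) α' ≤ sep α α') (hrel : r α α') :
    Clashes r K (B ∪ B') := by
  set θ := sep α α' with hθ
  have hf : ∀ p < K, sep (f p) α < θ := fun p hp => (h.lt p K hp hs).trans_le hα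
  have hf' : ∀ p < K, sep (f' p) α' < θ := fun p hp => (h'.lt p K hp hs).trans_le hα'
  -- the combs hang in the two different subtrees below the branching of `α` and `α'`
  have hfα' : ∀ p < K, sep (f p) α' = θ := fun p hp => by
    rw [sep_comm (f p), hθ, sep_comm α]
    exact sep_eq_of_lt (by rw [sep_comm α' α]; exact hf p hp)
  constructor
  · have hnot : α' ∉ (Finset.range (K - 1)).image f := by
      intro hmem
      obtain ⟨p, hp, hpα⟩ := Finset.mem_image.1 hmem
      have h1 := hfα' p (by have := Finset.mem_range.1 hp; omega)
      have h2 := hf p (by have := Finset.mem_range.1 hp; omega)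
      rw [hpα, sep_self] at h1
      omega
    have hmemf : ∀ p < K - 1, f p ∈ insert α' ((Finset.range (K - 1)).image f) := fun p hp =>
      Finset.mem_insert_of_mem (Finset.mem_image_of_mem f (Finset.mem_range.2 hp))
    have hfne : ∀ p < K - 1, f p ≠ α' := fun p hp he =>
      hnot (he ▸ Finset.mem_image_of_mem f (Finset.mem_range.2 hp))
    have hff : ∀ p q, p < q → q < K → f p ≠ f q := fun p q hpq hq he => by
      have := h.lt p q hpq (by omega)
      rw [he] at this
      omega
    have hrelf : ∀ p q, p < q → q < K → r (f q) (f p) := fun p q hpq hq =>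
      (hr.congr (h.lt p q hpq (by omega))).2 (h.rel q (by omega))
    refine ⟨insert α' ((Finset.range (K - 1)).image f), ?_, ?_, ?_, ?_, ?_⟩
    · exact Finset.insert_subset (Finset.mem_union_right _ h'.end_mem)
        ((h.image_subset (by omega)).trans Finset.subset_union_left)
    · rw [Finset.card_insert_of_notMem hnot, h.card_image (by omega)]; omega
    · refine ⟨α', Finset.mem_insert_self _ _, fun y hy z hz hyα hzα => ?_⟩
      obtain ⟨p, hp, rfl⟩ := Finset.mem_image.1 (Finset.mem_of_mem_insert_of_ne hy hyα)
      obtain ⟨q, hq, rfl⟩ := Finset.mem_image.1 (Finset.mem_of_mem_insert_of_ne hz hzα)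
      rw [Finset.mem_range] at hp hq
      rw [sep_comm α', hfα' p (by omega)]
      exact sep_lt_of_lt (hf p (by omega)) (hf q (by omega))
    · rintro ⟨β, hβ, hrelβ, hinj⟩
      rcases Finset.mem_insert.1 hβ with rfl | hβ
      · exact hff 0 1 (by omega) (by omega) (hinj _ (hmemf 0 (by omega)) _ (hmemf 1 (by omega))
          (hfne 0 (by omega)) (hfne 1 (by omega))
          (by rw [hfα' 0 (by omega), hfα' 1 (by omega)]))
      · obtain ⟨p, hp, rfl⟩ := Finset.mem_image.1 hβ
        rw [Finset.mem_range] at hp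
        have h1 := hrelβ α' (Finset.mem_insert_self _ _) (hfne p hp).symm
        refine hr.asymm h1 (hr.trans (h.rel p (by omega)) hrel)
    · rintro ⟨β, hβ, hrelβ, hinj⟩
      rcases Finset.mem_insert.1 hβ with rfl | hβ
      · exact hr.asymm (hrelβ _ (hmemf 0 (by omega)) (hfne 0 (by omega)))
          (hr.trans (h.rel 0 (by omega)) hrel)
      · obtain ⟨p, hp, rfl⟩ := Finset.mem_image.1 hβ
        rw [Finset.mem_range] at hp
        by_cases hp2 : p < K - 2
        · have h1 := hrelβ _ (hmemf (K - 2) (by omega)) (hff p _ hp2 (by omega)).symm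
          exact hr.asymm h1 (hrelf p _ hp2 (by omega))
        · have hsep : ∀ q < p, sep (f q) (f p) = sep (f p) α := fun q hq => by
            rw [sep_comm]; exact sep_eq_of_lt (h.lt q p hq (by omega))
          exact hff 0 1 (by omega) (by omega) (hinj _ (hmemf 0 (by omega)) _ (hmemf 1 (by omega))
            (hff 0 p (by omega) (by omega)) (hff 1 p (by omega) (by omega))
            (by rw [hsep 0 (by omega), hsep 1 (by omega)]))
  · have hcross : ∀ p < K, ∀ q < K, sep (f p) (f' q) = θ := fun p hp q hq => by
      have h1 := hfα' p hp
      rw [← h1]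
      exact sep_eq_of_lt (by rw [sep_comm _ α', sep_comm α', h1]; exact hf' q hq)
    have hL : ((Finset.range 2).image f).card = 2 := h.card_image (by omega)
    have hR : ((Finset.range (K - 2)).image f').card = K - 2 := h'.card_image (by omega)
    have hdisj : Disjoint ((Finset.range 2).image f) ((Finset.range (K - 2)).image f') := by
      rw [Finset.disjoint_left]
      intro x hx hx'
      obtain ⟨p, hp, rfl⟩ := Finset.mem_image.1 hx
      obtain ⟨q, hq, hpq⟩ := Finset.mem_image.1 hx'
      rw [Finset.mem_range] at hp hq
      have h1 := hcross p (by omega) q (by omega)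
      have h2 := hf p (by omega)
      rw [hpq, sep_self] at h1
      omega
    refine ⟨(Finset.range 2).image f ∪ (Finset.range (K - 2)).image f', ?_, ?_, ?_⟩
    · exact Finset.union_subset_union (h.image_subset (by omega)) (h'.image_subset (by omega))
    · rw [Finset.card_union_of_disjoint hdisj, hL, hR]; omega
    · refine not_hasIsolatedLeaf_union (d := θ) (by omega) (by omega) ?_ ?_ ?_
      · intro x hx y hy
        obtain ⟨p, hp, rfl⟩ := Finset.mem_image.1 hx
        obtain ⟨q, hq, rfl⟩ := Finset.mem_image.1 hy
        rw [Finset.mem_range] at hp hq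
        exact sep_lt_of_lt (hf p (by omega)) (hf q (by omega))
      · intro x hx y hy
        obtain ⟨p, hp, rfl⟩ := Finset.mem_image.1 hx
        obtain ⟨q, hq, rfl⟩ := Finset.mem_image.1 hy
        rw [Finset.mem_range] at hp hq
        exact sep_lt_of_lt (hf' p (by omega)) (hf' q (by omega))
      · intro x hx y hy
        obtain ⟨p, hp, rfl⟩ := Finset.mem_image.1 hx
        obtain ⟨q, hq, rfl⟩ := Finset.mem_image.1 hy
        rw [Finset.mem_range] at hp hq
        exact hcross p (by omega) q (by omega)

/-- Two combs whose low parts hang in different subtrees clash: one point on one side and the rest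
on the other is not a comb in the order `r`, and two points on one side leave no isolated leaf. -/
theorem clashes_of_apart (hr : IsTreeOrder r) {K : ℕ} (hK : 4 ≤ K) (hs : K < s)
    (h : IsCombSeq r s B α f) (h' : IsCombSeq r s B' α' f') (hne : α ≠ α')
    (hα : sep (f K) α ≤ sep α α') (hα' : sep (f' K) α' ≤ sep α α') :
    Clashes r K (B ∪ B') := by
  rcases hr.total hne with h1 | h1
  · exact clashes_of_apart_of_rel hr hK hs h h' hα hα' h1
  · rw [Finset.union_comm]
    rw [sep_comm α] at hα hα'
    exact clashes_of_apart_of_rel hr hK hs h' h hα' hα h1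

/-- A leaf `v` that leaves the path to `α` together with a middle term of a comb produces a
clash. -/
theorem clashes_of_same_height (hr : IsTreeOrder r) {K : ℕ} (hK : 4 ≤ K)
    (h : IsCombSeq r s B α f) {p : ℕ} (hp : K ≤ p) (hps : p + 1 < s) {v : ℕ} (hv : v ∈ B')
    (hvp : v ≠ f p) (hvα : r v α) (hsep : sep v α = sep (f p) α) : Clashes r K (B ∪ B') := by
  have hlow : ∀ q < K, sep (f q) α < sep (f p) α := fun q hq => h.lt q p (by omega) (by omega)
  have htop : sep (f p) α < sep (f (s - 1)) α := h.lt p (s - 1) (by omega) (by omega)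
  have hub : f p ∈ B ∪ B' := Finset.mem_union_left _ (h.mem p (by omega))
  have hvb : v ∈ B ∪ B' := Finset.mem_union_right _ hv
  have hne_of : ∀ {x y}, sep x α < sep y α → x ≠ y := fun hxy he => by
    rw [he] at hxy; omega
  have hrel_of : ∀ {x y}, sep x α < sep y α → r y α → r y x := fun hxy hy => (hr.congr hxy).2 hy
  have hsep_of : ∀ {x y}, sep x α < sep y α → sep y x = sep y α := fun hxy => sep_eq_of_lt hxy
  have hvu : v ∉ ({f p} : Finset ℕ) := by simpa using hvp
  have hpair : ∀ m ≤ K, ∀ x ∈ ({v, f p} : Finset ℕ), x ∉ (Finset.range m).image f := by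
    intro m hm x hx hx'
    obtain ⟨q, hq, rfl⟩ := Finset.mem_image.1 hx'
    have h1 := hlow q (by have := Finset.mem_range.1 hq; omega)
    rcases Finset.mem_insert.1 hx with hx | hx
    · rw [hx, hsep] at h1; omega
    · rw [Finset.mem_singleton.1 hx] at h1; omega
  have hdisj : ∀ m ≤ K, Disjoint ({v, f p} : Finset ℕ) ((Finset.range m).image f) :=
    fun m hm => Finset.disjoint_left.2 (hpair m hm)
  have hpairsub : ({v, f p} : Finset ℕ) ⊆ B ∪ B' :=
    Finset.insert_subset hvb (Finset.singleton_subset_iff.2 hub)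
  have hpairsep : ∀ x ∈ ({v, f p} : Finset ℕ), sep x α = sep (f p) α := by
    intro x hx
    rcases Finset.mem_insert.1 hx with hx | hx
    · rw [hx, hsep]
    · rw [Finset.mem_singleton.1 hx]
  have hpairrel : ∀ x ∈ ({v, f p} : Finset ℕ), r x α := by
    intro x hx
    rcases Finset.mem_insert.1 hx with hx | hx
    · rwa [hx]
    · rw [Finset.mem_singleton.1 hx]; exact h.rel p (by omega)
  constructor
  · set e := insert (f (s - 1)) ({v, f p} ∪ (Finset.range (K - 3)).image f) with he
    have hmem : ∀ x ∈ e, x = f (s - 1) ∨ x ∈ ({v, f p} : Finset ℕ) ∨ ∃ q < K - 3, x = f q := by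
      intro x hx
      rw [he, Finset.mem_insert, Finset.mem_union, Finset.mem_image] at hx
      rcases hx with hx | hx | ⟨q, hq, rfl⟩
      · exact Or.inl hx
      · exact Or.inr (Or.inl hx)
      · exact Or.inr (Or.inr ⟨q, Finset.mem_range.1 hq, rfl⟩)
    have hte : f (s - 1) ∈ e := Finset.mem_insert_self _ _
    have hpe : ∀ x ∈ ({v, f p} : Finset ℕ), x ∈ e := fun x hx =>
      Finset.mem_insert_of_mem (Finset.mem_union_left _ hx)
    have hv2 : v ∈ ({v, f p} : Finset ℕ) := by simp
    have hu2 : f p ∈ ({v, f p} : Finset ℕ) := by simp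
    have h0e : f 0 ∈ e := Finset.mem_insert_of_mem (Finset.mem_union_right _
      (Finset.mem_image_of_mem f (Finset.mem_range.2 (by omega))))
    have hbelow : ∀ x ∈ ({v, f p} ∪ (Finset.range (K - 3)).image f),
        sep x α < sep (f (s - 1)) α := by
      intro x hx
      rcases Finset.mem_union.1 hx with hx | hx
      · rwa [hpairsep x hx]
      · obtain ⟨q, hq, rfl⟩ := Finset.mem_image.1 hx
        exact (hlow q (by have := Finset.mem_range.1 hq; omega)).trans htop
    have hbelow' : ∀ x ∈ e, x ≠ f (s - 1) → sep x α < sep (f (s - 1)) α := fun x hx hne =>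
      hbelow x (Finset.mem_of_mem_insert_of_ne hx hne)
    have ht : f (s - 1) ∉ ({v, f p} ∪ (Finset.range (K - 3)).image f) := fun hx => by
      have := hbelow _ hx; omega
    have htrel : r (f (s - 1)) α := h.rel _ (by omega)
    refine ⟨e, ?_, ?_, ?_, ?_, ?_⟩
    · refine Finset.insert_subset (Finset.mem_union_left _ (h.mem _ (by omega)))
        (Finset.union_subset hpairsub ?_)
      exact (h.image_subset (by omega)).trans Finset.subset_union_left
    · rw [he, Finset.card_insert_of_notMem ht, Finset.card_union_of_disjoint (hdisj _ (by omega)),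
        h.card_image (by omega), Finset.card_pair hvp]
      omega
    · refine ⟨f (s - 1), hte, fun y hy z hz hyt hzt => ?_⟩
      rw [hsep_of (hbelow' y hy hyt)]
      exact sep_lt_of_lt (hbelow' y hy hyt) (hbelow' z hz hzt)
    · rintro ⟨β, hβ, hrelβ, hinj⟩
      rcases hmem β hβ with rfl | hβ' | ⟨q, hq, rfl⟩
      · exact hr.asymm (hrelβ _ (hpe _ hu2) (hne_of htop)) (hrel_of htop htrel)
      · have h1 : sep (f 0) α < sep β α := by
          rw [hpairsep β hβ']; exact hlow 0 (by omega)
        exact hr.asymm (hrelβ _ h0e (hne_of h1)) (hrel_of h1 (hpairrel β hβ'))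
      · have h1 := hlow q (by omega)
        have h2 : sep (f q) α < sep v α := by rwa [hsep]
        exact hvp (hinj _ (hpe _ hv2) _ (hpe _ hu2) (hne_of h2).symm (hne_of h1).symm
          (by rw [hsep_of h1, hsep_of h2, hsep]))
    · rintro ⟨β, hβ, hrelβ, hinj⟩
      by_cases hβt : β = f (s - 1)
      · subst hβt
        have h2 : sep v α < sep (f (s - 1)) α := by rwa [hsep]
        exact hvp (hinj _ (hpe _ hv2) _ (hpe _ hu2) (hne_of h2) (hne_of htop)
          (by rw [sep_comm v, sep_comm (f p), hsep_of htop, hsep_of h2]))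
      · exact hr.asymm (hrelβ _ hte (Ne.symm hβt)) (hrel_of (hbelow' β hβ hβt) htrel)
  · refine ⟨{v, f p} ∪ (Finset.range (K - 2)).image f, ?_, ?_, ?_⟩
    · exact Finset.union_subset hpairsub
        ((h.image_subset (by omega)).trans Finset.subset_union_left)
    · rw [Finset.card_union_of_disjoint (hdisj _ (by omega)), h.card_image (by omega),
        Finset.card_pair hvp]
      omega
    · have hlow' : ∀ x ∈ (Finset.range (K - 2)).image f, sep x α < sep (f p) α := by
        intro x hx
        obtain ⟨q, hq, rfl⟩ := Finset.mem_image.1 hx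
        exact hlow q (by have := Finset.mem_range.1 hq; omega)
      refine not_hasIsolatedLeaf_union (d := sep (f p) α) (by rw [Finset.card_pair hvp])
        (by rw [h.card_image (by omega)]; omega) ?_ ?_ ?_
      · intro x hx y hy
        rw [← hpairsep x hx]
        refine sep_lt_of_eq (hr.ne (hpairrel x hx)) ?_
        rw [hpairsep x hx, hpairsep y hy]
      · exact fun x hx y hy => sep_lt_of_lt (hlow' x hx) (hlow' y hy)
      · intro x hx y hy
        rw [hsep_of (by rw [hpairsep x hx]; exact hlow' y hy), hpairsep x hx]

/-- The heights of `b` consecutive terms of a comb, from the term `K` on, counted from `0`. -/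
def middleHeights (K b : ℕ) (α : ℕ) (f : ℕ → ℕ) : Finset ℕ :=
  (Finset.range b).image fun p => sep (f (K + p)) α - 1

theorem IsCombSeq.card_middleHeights (hr : IsTreeOrder r) {K b : ℕ}
    (h : IsCombSeq r s B α f) (hs : K + b < s) : (middleHeights K b α f).card = b := by
  rw [middleHeights, Finset.card_image_of_injOn, Finset.card_range]
  intro p hp q hq hpq
  simp only [Finset.coe_range, Set.mem_Iio] at hp hq
  have h1 := sep_pos (hr.ne (h.rel (K + p) (by omega)))
  have h2 := sep_pos (hr.ne (h.rel (K + q) (by omega)))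
  simp only at hpq
  by_contra hne
  rcases lt_or_gt_of_ne hne with h3 | h3
  · have := h.lt (K + p) (K + q) (by omega) (by omega); omega
  · have := h.lt (K + q) (K + p) (by omega) (by omega); omega

/-- What the middle parts of two combs that do not clash look like: they hang off one common path,
so that any set of their heights is the set of branchings of a comb in the union. -/
def Merges (r : ℕ → ℕ → Prop) (K : ℕ) (U Δ Δ' : Finset ℕ) : Prop :=
  Disjoint Δ Δ' ∧ ∀ D ⊆ Δ ∪ Δ', D.card + 1 = K →
    ∃ e ⊆ U, e.card = K ∧ IsComb r e ∧ branchings e = D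

theorem merges_of_lt (hr : IsTreeOrder r) {K b : ℕ} (hK : 4 ≤ K) (hs : K + b < s)
    (h : IsCombSeq r s B α f) (h' : IsCombSeq r s B' α' f') (hB : Disjoint B B')
    (hcl : ¬ Clashes r K (B ∪ B')) (hlt : sep α α' < sep (f' K) α') :
    Merges r K (B ∪ B') (middleHeights K b α f) (middleHeights K b α' f') := by
  have hsep : ∀ p < b, sep (f' (K + p)) α = sep (f' (K + p)) α' := fun p hp =>
    sep_eq_of_lt (hlt.trans_le (h'.sep_le (by omega) (by omega)))
  have hrel : ∀ p < b, r (f' (K + p)) α := fun p hp =>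
    (hr.congr (hlt.trans_le (h'.sep_le (by omega) (by omega)))).2 (h'.rel _ (by omega))
  constructor
  · rw [Finset.disjoint_left]
    intro d hd hd'
    obtain ⟨p, hp, rfl⟩ := Finset.mem_image.1 hd
    obtain ⟨q, hq, hpq⟩ := Finset.mem_image.1 hd'
    rw [Finset.mem_range] at hp hq
    have h1 := sep_pos (hr.ne (h.rel (K + p) (by omega)))
    have h2 := sep_pos (hr.ne (h'.rel (K + q) (by omega)))
    have hmem := h'.mem (K + q) (by omega)
    refine hcl (clashes_of_same_height hr hK h (p := K + p) (by omega) (by omega) hmem ?_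
      (hrel q hq) (by rw [hsep q hq]; omega))
    intro he
    exact Finset.disjoint_left.1 hB (h.mem (K + p) (by omega)) (he ▸ hmem)
  · intro D hD hcard
    have hpt : ∀ d ∈ D, ∃ x ∈ B ∪ B', r x α ∧ sep x α = d + 1 := by
      intro d hd
      rcases Finset.mem_union.1 (hD hd) with hd | hd
      · obtain ⟨p, hp, rfl⟩ := Finset.mem_image.1 hd
        rw [Finset.mem_range] at hp
        have h1 := sep_pos (hr.ne (h.rel (K + p) (by omega)))
        exact ⟨f (K + p), Finset.mem_union_left _ (h.mem _ (by omega)), h.rel _ (by omega),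
          by omega⟩
      · obtain ⟨p, hp, rfl⟩ := Finset.mem_image.1 hd
        rw [Finset.mem_range] at hp
        have h1 := sep_pos (hr.ne (h'.rel (K + p) (by omega)))
        exact ⟨f' (K + p), Finset.mem_union_right _ (h'.mem _ (by omega)), hrel p hp,
          by rw [hsep p hp]; omega⟩
    choose! g hgU hgr hgs using hpt
    have hα : α ∉ D.image g := by
      intro hα
      obtain ⟨d, hd, hdα⟩ := Finset.mem_image.1 hα
      exact hr.ne (hgr d hd) hdα
    have hcomb : IsCombAt r (insert α (D.image g)) α := by
      refine ⟨Finset.mem_insert_self _ _, fun a ha hne => ?_, fun a ha c hc hne hne' hac => ?_⟩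
      · obtain ⟨d, hd, rfl⟩ := Finset.mem_image.1 (Finset.mem_of_mem_insert_of_ne ha hne)
        exact hgr d hd
      · obtain ⟨d, hd, rfl⟩ := Finset.mem_image.1 (Finset.mem_of_mem_insert_of_ne ha hne)
        obtain ⟨d', hd', rfl⟩ := Finset.mem_image.1 (Finset.mem_of_mem_insert_of_ne hc hne')
        rw [hgs d hd, hgs d' hd'] at hac
        rw [show d = d' by omega]
    refine ⟨insert α (D.image g), ?_, ?_, ⟨α, hcomb⟩, ?_⟩
    · refine Finset.insert_subset (Finset.mem_union_left _ h.end_mem) fun x hx => ?_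
      obtain ⟨d, hd, rfl⟩ := Finset.mem_image.1 hx
      exact hgU d hd
    · rw [Finset.card_insert_of_notMem hα, Finset.card_image_of_injOn, hcard]
      intro d hd d' hd' hdd
      have h1 := hgs d hd
      have h2 := hgs d' hd'
      rw [hdd] at h1
      omega
    · rw [hcomb.branchings_eq, Finset.erase_insert hα, Finset.image_image]
      conv_rhs => rw [← Finset.image_id (s := D)]
      refine Finset.image_congr fun d hd => ?_
      simp [hgs d hd]

theorem merges_of_not_clashes (hr : IsTreeOrder r) {K b : ℕ} (hK : 4 ≤ K) (hs : K + b < s)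
    (h : IsCombSeq r s B α f) (h' : IsCombSeq r s B' α' f') (hB : Disjoint B B')
    (hcl : ¬ Clashes r K (B ∪ B')) :
    Merges r K (B ∪ B') (middleHeights K b α f) (middleHeights K b α' f') := by
  have hne : α ≠ α' := fun he => Finset.disjoint_left.1 hB h.end_mem (he ▸ h'.end_mem)
  by_cases h1 : sep α α' < sep (f' K) α'
  · exact merges_of_lt hr hK hs h h' hB hcl h1
  by_cases h2 : sep α α' < sep (f K) α
  · rw [Finset.union_comm] at hcl
    rw [sep_comm] at h2
    have := merges_of_lt hr hK hs h' h hB.symm hcl h2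
    rw [Merges, Finset.union_comm B' B, disjoint_comm,
      Finset.union_comm (middleHeights K b α' f')] at this
    exact this
  · exact absurd (clashes_of_apart hr hK (by omega) h h' hne (not_lt.1 h2) (not_lt.1 h1)) hcl

end Combs

/-! ### Colorings without monochromatic systems of blocks -/

/-- A sequence of `n` disjoint blocks of size `b` in `{0, …, N - 1}`. -/
structure IsBlockFamily {n : ℕ} (b N : ℕ) (B : Fin n → Finset ℕ) : Prop where
  card : ∀ i, (B i).card = b
  lt : ∀ i, ∀ x ∈ B i, x < N
  disjoint : ∀ i j, i ≠ j → Disjoint (B i) (B j)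

/-- All `k`-sets that are contained in the union of two of the blocks have the color `c`. -/
def IsMonochromatic {C : Type*} {n : ℕ} (k : ℕ) (χ : Finset ℕ → C) (B : Fin n → Finset ℕ)
    (c : C) : Prop :=
  ∀ i j, i ≠ j → ∀ e ⊆ B i ∪ B j, e.card = k → χ e = c

/-- There is a `q`-coloring of the `k`-subsets of `{0, …, N - 1}` without a monochromatic family of
`n` blocks of size `b`. -/
def HasBlockColoring (q k b n N : ℕ) : Prop :=
  ∃ χ : Finset ℕ → Fin q, ∀ B : Fin n → Finset ℕ, IsBlockFamily b N B →
    ∀ c, ¬ IsMonochromatic k χ B c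

theorem HasBlockColoring.mono_colors {q q' k b n N : ℕ} (hq : q ≤ q')
    (h : HasBlockColoring q k b n N) (hn : 2 ≤ n) (hkb : k ≤ 2 * b) :
    HasBlockColoring q' k b n N := by
  obtain ⟨χ, hχ⟩ := h
  refine ⟨fun e => Fin.castLE hq (χ e), fun B hB c hc => ?_⟩
  -- some `k`-set is contained in the first two blocks, so that `c` is an old color
  have h01 : (⟨0, by omega⟩ : Fin n) ≠ ⟨1, by omega⟩ := by simp
  obtain ⟨e, he, hek⟩ := Finset.exists_subset_card_eq
    (s := B ⟨0, by omega⟩ ∪ B ⟨1, by omega⟩) (n := k) (by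
      rw [Finset.card_union_of_disjoint (hB.disjoint _ _ h01), hB.card, hB.card]; omega)
  have h0 := hc _ _ h01 e he hek
  refine hχ B hB (χ e) fun i j hij e' he' hek' => ?_
  have h1 := hc i j hij e' he' hek'
  rw [← h0] at h1
  exact Fin.castLE_injective hq h1

/-! ### Stepping up from uniformity at least three -/

theorem not_isMonochromatic_of_combs {k b n m N : ℕ} (hk : 3 ≤ k) {r : ℕ → ℕ → Prop}
    (hr : IsTreeOrder r) {φ χ : Finset ℕ → Fin 4}
    (hφ : ∀ B : Fin n → Finset ℕ, IsBlockFamily b N B → ∀ c, ¬ IsMonochromatic k φ B c)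
    (hcomb : ∀ e, IsComb r e → χ e = φ (branchings e))
    (hone : ∀ e, HasIsolatedLeaf e → ¬ IsComb r e → ¬ IsComb (flip r) e → χ e = 1)
    (hzero : ∀ e, e.card = k + 1 → ¬ HasIsolatedLeaf e → χ e = 0)
    {B : Fin m → Finset ℕ} {β : ℕ} (hB : IsBlockFamily β (2 ^ N) B) {T : Finset (Fin m)}
    (hT : n ≤ T.card) {α : Fin m → ℕ} {f : Fin m → ℕ → ℕ}
    (hf : ∀ i ∈ T, IsCombSeq r (k + b + 2) (B i) (α i) (f i)) (c : Fin 4) :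
    ¬ IsMonochromatic (k + 1) χ B c := by
  intro hc
  set g := T.orderEmbOfCardLe hT with hg
  have hgT : ∀ i, g i ∈ T := T.orderEmbOfCardLe_mem hT
  have hmerge : ∀ i j, i ≠ j → Merges r (k + 1) (B (g i) ∪ B (g j))
      (middleHeights (k + 1) b (α (g i)) (f (g i)))
      (middleHeights (k + 1) b (α (g j)) (f (g j))) := by
    intro i j hij
    have hgij : g i ≠ g j := fun h => hij (g.injective h)
    refine merges_of_not_clashes hr (by omega) (by omega) (hf _ (hgT i)) (hf _ (hgT j))
      (hB.disjoint _ _ hgij) ?_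
    rintro ⟨⟨e, heU, hek, hiso, h1, h2⟩, e', heU', hek', hiso'⟩
    have h3 := hc _ _ hgij e heU hek
    have h4 := hc _ _ hgij e' heU' hek'
    rw [hone e hiso h1 h2] at h3
    rw [hzero e' hek' hiso'] at h4
    exact absurd (h3.trans h4.symm) (by decide)
  refine hφ (fun i => middleHeights (k + 1) b (α (g i)) (f (g i))) ⟨fun i => ?_, fun i d hd => ?_,
    fun i j hij => (hmerge i j hij).1⟩ c fun i j hij D hD hDk => ?_
  · exact (hf _ (hgT i)).card_middleHeights hr (by omega)
  · obtain ⟨p, hp, rfl⟩ := Finset.mem_image.1 hd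
    rw [Finset.mem_range] at hp
    have h := hf _ (hgT i)
    have h1 := sep_pos (hr.ne (h.rel (k + 1 + p) (by omega)))
    have h2 := sep_le_of_lt_two_pow (hB.lt _ _ (h.mem (k + 1 + p) (by omega)))
      (hB.lt _ _ h.end_mem)
    omega
  · obtain ⟨e, heU, hek, hecomb, rfl⟩ := (hmerge i j hij).2 D hD (by omega)
    rw [← hcomb e hecomb]
    exact hc _ _ (fun h => hij (g.injective h)) e heU hek

open Classical in
/-- Combs are colored by their sets of branchings, and the other sets by whether they have an
isolated leaf. Large blocks contain combs, and those of at least `n` of the `2 * n` blocks have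
their ends on the same side. -/
theorem HasBlockColoring.step {k b n N : ℕ} (hk : 3 ≤ k) (h : HasBlockColoring 4 k b n N) :
    HasBlockColoring 4 (k + 1) (2 ^ (2 * (k + b + 2))) (2 * n) (2 ^ N) := by
  obtain ⟨φ, hφ⟩ := h
  set χ : Finset ℕ → Fin 4 := fun e =>
    if IsComb (· < ·) e ∨ IsComb (flip (· < ·)) e then φ (branchings e)
    else if HasIsolatedLeaf e then 1 else 0 with hχ
  refine ⟨χ, fun B hB c => ?_⟩
  have hseq : ∀ i, ∃ α f, IsCombSeq (· < ·) (k + b + 2) (B i) α f ∨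
      IsCombSeq (flip (· < ·)) (k + b + 2) (B i) α f :=
    fun i => exists_isCombSeq (hB.card i).ge
  choose α f hf using hseq
  have hzero : ∀ e : Finset ℕ, e.card = k + 1 → ¬ HasIsolatedLeaf e → χ e = 0 := by
    intro e hek hiso
    have h1 : ∀ r, ¬ IsComb r e := fun r ⟨β, hβ⟩ => hiso (hβ.hasIsolatedLeaf (by omega))
    simp only [hχ, h1, hiso, or_self, if_false]
  have hcard := Finset.card_filter_add_card_filter_not (s := (Finset.univ : Finset (Fin (2 * n))))
    fun i => IsCombSeq (· < ·) (k + b + 2) (B i) (α i) (f i)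
  rw [Finset.card_univ, Fintype.card_fin] at hcard
  rcases le_or_gt n (Finset.univ.filter fun i =>
    IsCombSeq (· < ·) (k + b + 2) (B i) (α i) (f i)).card with h1 | h1
  · refine not_isMonochromatic_of_combs hk isTreeOrder_lt hφ (fun e he => ?_)
      (fun e h1 h2 h3 => ?_) hzero hB h1 (α := α) (f := f)
      (fun i hi => (Finset.mem_filter.1 hi).2) c
    · simp only [hχ, he, true_or, if_true]
    · simp only [hχ, h1, h2, h3, or_self, if_true, if_false]
  · refine not_isMonochromatic_of_combs (n := n) hk isTreeOrder_lt.flip hφ (fun e he => ?_)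
      (fun e h1 h2 h3 => ?_) hzero hB (T := Finset.univ.filter fun i =>
        ¬ IsCombSeq (· < ·) (k + b + 2) (B i) (α i) (f i)) (by omega) (α := α) (f := f)
      (fun i hi => (hf i).resolve_left (Finset.mem_filter.1 hi).2) c
    · simp only [hχ, he, or_true, if_true]
    · have h3' : ¬ IsComb (· < ·) e := h3
      simp only [hχ, h1, h2, h3', or_self, if_true, if_false]

/-! ### Stepping up from graphs to triples -/

theorem isComb_or_isComb_flip_of_card_eq_three {e : Finset ℕ} (he : e.card = 3) :
    IsComb (· < ·) e ∨ IsComb (flip (· < ·)) e := by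
  have key : ∀ x y z : ℕ, x < y → y < z →
      IsComb (· < ·) {x, y, z} ∨ IsComb (flip (· < ·)) {x, y, z} := by
    intro x y z hxy hyz
    by_cases h : sep x z = sep y z
    · have h1 : sep x y < sep x z := sep_lt_of_eq (by omega) h
      refine Or.inr ⟨x, by simp, ?_, ?_⟩
      · simp only [Finset.mem_insert, Finset.mem_singleton, flip]
        omega
      · rw [sep_comm x y, sep_comm x z] at h1
        simp only [Finset.mem_insert, Finset.mem_singleton]
        rintro a (rfl | rfl | rfl) b (rfl | rfl | rfl) <;> omega
    · refine Or.inl ⟨z, by simp, ?_, ?_⟩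
      · simp only [Finset.mem_insert, Finset.mem_singleton]
        omega
      · simp only [Finset.mem_insert, Finset.mem_singleton]
        rintro a (rfl | rfl | rfl) b (rfl | rfl | rfl) <;> omega
  obtain ⟨x, y, z, hxy, hxz, hyz, rfl⟩ := Finset.card_eq_three.1 he
  have e1 : ({x, z, y} : Finset ℕ) = {x, y, z} := by ext; simp; tauto
  have e2 : ({y, x, z} : Finset ℕ) = {x, y, z} := by ext; simp; tauto
  have e3 : ({y, z, x} : Finset ℕ) = {x, y, z} := by ext; simp; tauto
  have e4 : ({z, x, y} : Finset ℕ) = {x, y, z} := by ext; simp; tauto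
  have e5 : ({z, y, x} : Finset ℕ) = {x, y, z} := by ext; simp; tauto
  rcases lt_or_gt_of_ne hxy with h1 | h1 <;> rcases lt_or_gt_of_ne hxz with h2 | h2 <;>
    rcases lt_or_gt_of_ne hyz with h3 | h3
  · exact key _ _ _ h1 h3
  · exact e1 ▸ key _ _ _ h2 h3
  · omega
  · exact e4 ▸ key _ _ _ h2 h1
  · exact e2 ▸ key _ _ _ h1 h2
  · omega
  · exact e3 ▸ key _ _ _ h3 h2
  · exact e5 ▸ key _ _ _ h3 h1

theorem IsComb.sep_ne {r : ℕ → ℕ → Prop} (hr : IsTreeOrder r) {x y α : ℕ}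
    (h : IsComb r {x, y, α}) (hx : r x α) (hy : r y α) (hxy : x ≠ y) : sep x α ≠ sep y α := by
  obtain ⟨β, hβ, hrel, hinj⟩ := h
  have hβα : β = α := by
    by_contra hne
    have h1 := hrel α (by simp) (Ne.symm hne)
    simp only [Finset.mem_insert, Finset.mem_singleton] at hβ
    rcases hβ with rfl | rfl | rfl
    · exact hr.asymm h1 hx
    · exact hr.asymm h1 hy
    · exact hne rfl
  subst hβα
  exact fun h => hxy (hinj x (by simp) y (by simp) (hr.ne hx) (hr.ne hy) h)

theorem branchings_triple {r : ℕ → ℕ → Prop} (hr : IsTreeOrder r) {x y α : ℕ} (hx : r x α)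
    (hy : r y α) (hxy : sep x α ≠ sep y α) :
    branchings {x, y, α} = {sep x α - 1, sep y α - 1} := by
  have hcomb : IsCombAt r {x, y, α} α := by
    refine ⟨by simp, ?_, ?_⟩
    · simp only [Finset.mem_insert, Finset.mem_singleton]
      rintro a (rfl | rfl | rfl) <;> tauto
    · simp only [Finset.mem_insert, Finset.mem_singleton]
      rintro a (rfl | rfl | rfl) b (rfl | rfl | rfl) <;> tauto
  have h1 := hr.ne hx
  have h2 := hr.ne hy
  have h3 : ({x, y, α} : Finset ℕ).erase α = {x, y} := by
    ext a
    simp only [Finset.mem_erase, Finset.mem_insert, Finset.mem_singleton]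
    constructor
    · tauto
    · rintro (rfl | rfl) <;> tauto
  rw [hcomb.branchings_eq, h3, Finset.image_insert, Finset.image_singleton]

/-- If all triples in the union of two pairs are combs on the same side, then the pairs branch at
different heights, and these are the two branchings of one of the triples. -/
theorem exists_triple_of_pairs {r : ℕ → ℕ → Prop} (hr : IsTreeOrder r) {a b a' b' : ℕ}
    (hab : r a b) (hab' : r a' b') (hdisj : Disjoint ({a, b} : Finset ℕ) {a', b'})
    (hcomb : ∀ e ⊆ ({a, b} : Finset ℕ) ∪ {a', b'}, e.card = 3 → IsComb r e) :
    sep a b ≠ sep a' b' ∧ ∃ e ⊆ ({a, b} : Finset ℕ) ∪ {a', b'}, e.card = 3 ∧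
      branchings e = {sep a b - 1, sep a' b' - 1} := by
  have key : ∀ {a b a' b' : ℕ}, r a b → r a' b' → Disjoint ({a, b} : Finset ℕ) {a', b'} →
      (∀ e ⊆ ({a, b} : Finset ℕ) ∪ {a', b'}, e.card = 3 → IsComb r e) → r b b' →
      sep a b ≠ sep a' b' ∧ ∃ e ⊆ ({a, b} : Finset ℕ) ∪ {a', b'}, e.card = 3 ∧
      branchings e = {sep a b - 1, sep a' b' - 1} := by
    intro a b a' b' hab hab' hdisj hcomb hbb'
    have hne := hr.ne hab
    have hne' := hr.ne hab'
    simp only [Finset.disjoint_left, Finset.mem_insert, Finset.mem_singleton, not_or,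
      forall_eq_or_imp, forall_eq] at hdisj
    obtain ⟨⟨n1, n2⟩, n3, n4⟩ := hdisj
    have hbr : ∀ x y z, x ∈ ({a, b} : Finset ℕ) ∪ {a', b'} → y ∈ ({a, b} : Finset ℕ) ∪ {a', b'} →
        z ∈ ({a, b} : Finset ℕ) ∪ {a', b'} → x ≠ y → x ≠ z → y ≠ z →
        ({x, y, z} : Finset ℕ) ⊆ ({a, b} : Finset ℕ) ∪ {a', b'} ∧
          ({x, y, z} : Finset ℕ).card = 3 := by
      intro x y z hx hy hz h1 h2 h3
      refine ⟨?_, Finset.card_eq_three.2 ⟨x, y, z, h1, h2, h3, rfl⟩⟩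
      simp only [Finset.insert_subset_iff, Finset.singleton_subset_iff]
      exact ⟨hx, hy, hz⟩
    have t1 := hbr a b b' (by simp) (by simp) (by simp) hne n2 n4
    have t2 := hbr a a' b' (by simp) (by simp) (by simp) n1 n2 hne'
    have t3 := hbr b a' b' (by simp) (by simp) (by simp) n3 n4 hne'
    have hab'' : r a b' := hr.trans hab hbb'
    have s1 := (hcomb _ t1.1 t1.2).sep_ne hr hab'' hbb' hne
    have s2 := (hcomb _ t2.1 t2.2).sep_ne hr hab'' hab' n1
    have s3 := (hcomb _ t3.1 t3.2).sep_ne hr hbb' hab' n3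
    rcases lt_or_gt_of_ne s1 with h | h
    · have h1 : sep a b = sep b b' := by rw [sep_comm]; exact sep_eq_of_lt h
      rw [h1]
      exact ⟨s3, _, t3.1, t3.2, branchings_triple hr hbb' hab' s3⟩
    · have h1 : sep a b = sep a b' := sep_eq_of_lt h
      rw [h1]
      exact ⟨s2, _, t2.1, t2.2, branchings_triple hr hab'' hab' s2⟩
  have hne : b ≠ b' := by
    rintro rfl
    exact Finset.disjoint_left.1 hdisj (show b ∈ _ by simp) (by simp)
  rcases hr.total hne with h | h
  · exact key hab hab' hdisj hcomb h
  · rw [Finset.union_comm] at hcomb ⊢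
    obtain ⟨h1, e, h2, h3, h4⟩ := key hab' hab hdisj.symm hcomb h
    exact ⟨h1.symm, e, h2, h3, by rw [h4, Finset.pair_comm]⟩

theorem not_forall_isComb_of_pairs {n N : ℕ} {r : ℕ → ℕ → Prop} (hr : IsTreeOrder r)
    {φ : Finset ℕ → Fin 2}
    (hφ : ∀ B : Fin n → Finset ℕ, IsBlockFamily 1 N B → ∀ c, ¬ IsMonochromatic 2 φ B c)
    {B : Fin n → Finset ℕ} (hB : IsBlockFamily 2 (2 ^ N) B) (c : Fin 2) :
    ¬ ∀ i j, i ≠ j → ∀ e ⊆ B i ∪ B j, e.card = 3 → IsComb r e ∧ φ (branchings e) = c := by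
  intro hc
  have hpair : ∀ i, ∃ a b, r a b ∧ B i = {a, b} := by
    intro i
    obtain ⟨x, y, hxy, h⟩ := Finset.card_eq_two.1 (hB.card i)
    rcases hr.total hxy with h1 | h1
    · exact ⟨x, y, h1, h⟩
    · exact ⟨y, x, h1, h.trans (Finset.pair_comm _ _)⟩
  choose a b hab hBab using hpair
  have hkey : ∀ i j, i ≠ j → sep (a i) (b i) ≠ sep (a j) (b j) ∧ ∃ e ⊆ B i ∪ B j, e.card = 3 ∧
      branchings e = {sep (a i) (b i) - 1, sep (a j) (b j) - 1} := by
    intro i j hij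
    have h1 := hB.disjoint i j hij
    have h2 := fun e he hek => (hc i j hij e he hek).1
    rw [hBab i, hBab j] at h1 h2 ⊢
    exact exists_triple_of_pairs hr (hab i) (hab j) h1 h2
  have hpos := fun i => sep_pos (hr.ne (hab i))
  have hne : ∀ i j, i ≠ j → sep (a i) (b i) - 1 ≠ sep (a j) (b j) - 1 := by
    intro i j hij
    have := (hkey i j hij).1
    have := hpos i
    have := hpos j
    omega
  refine hφ (fun i => {sep (a i) (b i) - 1}) ⟨fun i => Finset.card_singleton _, fun i d hd => ?_,
    fun i j hij => ?_⟩ c fun i j hij D hD hDk => ?_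
  · have h1 := sep_le_of_lt_two_pow (hB.lt i (a i) (by rw [hBab]; simp))
      (hB.lt i (b i) (by rw [hBab]; simp))
    have := hpos i
    rw [Finset.mem_singleton.1 hd]
    omega
  · rw [Finset.disjoint_singleton]
    exact hne i j hij
  · obtain ⟨e, heU, hek, hbr⟩ := (hkey i j hij).2
    have hDeq : D = {sep (a i) (b i) - 1, sep (a j) (b j) - 1} :=
      Finset.eq_of_subset_of_card_le hD
        (by rw [hDk]; exact Finset.card_le_two)
    rw [hDeq, ← hbr]
    exact (hc i j hij e heU hek).2

open Classical in
/-- The color of a triple records the color of its pair of branchings and the side of its end. -/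
theorem HasBlockColoring.step_pairs {n N : ℕ} (h : HasBlockColoring 2 2 1 n N) :
    HasBlockColoring 4 3 2 n (2 ^ N) := by
  obtain ⟨φ, hφ⟩ := h
  refine ⟨fun e => if IsComb (· < ·) e then Fin.castAdd 2 (φ (branchings e))
    else Fin.natAdd 2 (φ (branchings e)), fun B hB c => ?_⟩
  have hne : ∀ x y : Fin 2, Fin.natAdd 2 x ≠ Fin.castAdd 2 y := by decide
  refine Fin.addCases (m := 2) (n := 2) (fun c hc => ?_) (fun c hc => ?_) c
  · refine not_forall_isComb_of_pairs isTreeOrder_lt hφ hB c fun i j hij e he hek => ?_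
    have h1 := hc i j hij e he hek
    by_cases h2 : IsComb (· < ·) e
    · simp only [h2, if_true] at h1
      exact ⟨h2, Fin.castAdd_injective 2 2 h1⟩
    · simp only [h2, if_false] at h1
      exact absurd h1 (hne _ _)
  · refine not_forall_isComb_of_pairs isTreeOrder_lt.flip hφ hB c fun i j hij e he hek => ?_
    have h1 := hc i j hij e he hek
    by_cases h2 : IsComb (· < ·) e
    · simp only [h2, if_true] at h1
      exact absurd h1.symm (hne _ _)
    · simp only [h2, if_false] at h1
      exact ⟨(isComb_or_isComb_flip_of_card_eq_three hek).resolve_left h2,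
        Fin.natAdd_injective 2 2 h1⟩

/-! ### The coloring of graphs -/

/-- A family of fewer than `2 ^ (M - 1)` sets of size `M` can be `2`-colored without a monochromatic
member; the coloring is given by its set `T` of elements of the first color. -/
theorem exists_not_subset_not_disjoint {ι : Type*} [DecidableEq ι] {E : Finset ι}
    {S : Finset (Finset ι)} {M : ℕ} (hS : ∀ F ∈ S, F ⊆ E ∧ F.card = M) (hM : S.card * 2 < 2 ^ M) :
    ∃ T, ∀ F ∈ S, ¬ F ⊆ T ∧ ¬ Disjoint F T := by
  by_contra! hcon
  have hcover : E.powerset ⊆ S.biUnion fun F => Finset.Icc F E ∪ (E \ F).powerset := by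
    intro T hT
    rw [Finset.mem_powerset] at hT
    obtain ⟨F, hF, h⟩ := hcon T
    refine Finset.mem_biUnion.2 ⟨F, hF, Finset.mem_union.2 ?_⟩
    by_cases h1 : F ⊆ T
    · exact Or.inl (Finset.mem_Icc.2 ⟨h1, hT⟩)
    · exact Or.inr (Finset.mem_powerset.2 (Finset.subset_sdiff.2 ⟨hT, (h h1).symm⟩))
  have hcard : ∀ F ∈ S, (Finset.Icc F E ∪ (E \ F).powerset).card ≤ 2 * 2 ^ (E.card - M) := by
    intro F hF
    refine (Finset.card_union_le _ _).trans ?_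
    rw [Finset.card_Icc_finset (hS F hF).1, Finset.card_powerset,
      Finset.card_sdiff_of_subset (hS F hF).1, (hS F hF).2]
    omega
  have h1 := (Finset.card_le_card hcover).trans (Finset.card_biUnion_le_card_mul _ _ _ hcard)
  rw [Finset.card_powerset] at h1
  have hME : M ≤ E.card := by
    obtain ⟨F, hF, -⟩ := hcon ∅
    rw [← (hS F hF).2]
    exact Finset.card_le_card (hS F hF).1
  have h2 : 2 ^ E.card = 2 ^ M * 2 ^ (E.card - M) := by rw [← pow_add]; congr 1; omega
  rw [h2, ← mul_assoc] at h1
  exact absurd (Nat.le_of_mul_le_mul_right h1 (by positivity)) (by omega)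

/-- The lower bound of Erdős for the Ramsey number of a complete graph. -/
theorem hasBlockColoring_pairs {a : ℕ} (ha : 1 ≤ a) :
    HasBlockColoring 2 2 1 (4 * a + 2) (2 ^ a) := by
  set n := 4 * a + 2 with hn
  have hchoose : n.choose 2 = 8 * a * a + 6 * a + 1 := by
    rw [Nat.choose_two_right, hn]
    apply Nat.div_eq_of_eq_mul_left (by norm_num)
    rw [show 4 * a + 2 - 1 = 4 * a + 1 by omega]
    ring
  obtain ⟨T, hT⟩ := exists_not_subset_not_disjoint (E := (Finset.range (2 ^ a)).powersetCard 2)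
    (S := ((Finset.range (2 ^ a)).powersetCard n).image (Finset.powersetCard 2)) (M := n.choose 2)
    (by
      intro F hF
      obtain ⟨X, hX, rfl⟩ := Finset.mem_image.1 hF
      rw [Finset.mem_powersetCard] at hX
      exact ⟨Finset.powersetCard_mono hX.1, by rw [Finset.card_powersetCard, hX.2]⟩)
    (by
      have h1 : (((Finset.range (2 ^ a)).powersetCard n).image (Finset.powersetCard 2)).card ≤
          (2 ^ a) ^ n := by
        refine Finset.card_image_le.trans ?_
        rw [Finset.card_powersetCard, Finset.card_range]
        exact Nat.choose_le_pow _ _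
      calc _ ≤ (2 ^ a) ^ n * 2 := Nat.mul_le_mul_right _ h1
        _ = 2 ^ (a * n + 1) := by rw [← pow_mul, pow_succ]
        _ < 2 ^ n.choose 2 := by
          apply Nat.pow_lt_pow_right (by norm_num)
          rw [hchoose, hn]
          nlinarith)
  refine ⟨fun e => if e ∈ T then 1 else 0, fun B hB c hc => ?_⟩
  choose x hx using fun i => Finset.card_eq_one.1 (hB.card i)
  have hinj : Function.Injective x := by
    intro i j hij
    by_contra hne
    have := hB.disjoint i j hne
    rw [hx i, hx j, hij] at this
    simp at this
  set X := Finset.univ.image x with hX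
  have hXn : X ∈ (Finset.range (2 ^ a)).powersetCard n := by
    rw [Finset.mem_powersetCard]
    refine ⟨fun y hy => ?_, ?_⟩
    · obtain ⟨i, -, rfl⟩ := Finset.mem_image.1 hy
      exact Finset.mem_range.2 (hB.lt i _ (by rw [hx i]; simp))
    · rw [hX, Finset.card_image_of_injective _ hinj, Finset.card_univ, Fintype.card_fin]
  have hcol : ∀ e ∈ X.powersetCard 2, (if e ∈ T then (1 : Fin 2) else 0) = c := by
    intro e he
    rw [Finset.mem_powersetCard] at he
    obtain ⟨y, z, hyz, rfl⟩ := Finset.card_eq_two.1 he.2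
    obtain ⟨i, -, rfl⟩ := Finset.mem_image.1 (he.1 (by simp : y ∈ _))
    obtain ⟨j, -, rfl⟩ := Finset.mem_image.1 (he.1 (by simp : z ∈ _))
    refine hc i j (fun h => hyz (by rw [h])) _ ?_ he.2
    rw [hx i, hx j]
    rfl
  obtain ⟨h1, h2⟩ := hT _ (Finset.mem_image_of_mem _ hXn)
  obtain ⟨e, he, heT⟩ := Finset.not_subset.1 h1
  obtain ⟨e', he', heT'⟩ := Finset.not_disjoint_iff.1 h2
  have h3 := (hcol e he).trans (hcol e' he').symm
  simp [heT, heT'] at h3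

/-! ### Iterating the step -/

/-- The tower `2 ^ (2 ^ ⋯ ^ a)` with `j + 1` twos; the value of `tower (j + 2)` at `a`. -/
def natTower (a : ℕ) : ℕ → ℕ
  | 0 => 2 ^ a
  | j + 1 => 2 ^ natTower a j

theorem tower_natCast (a j : ℕ) : tower (j + 2) (a : ℝ) = natTower a j := by
  induction j with
  | zero => simp [tower, natTower]
  | succ j ih =>
    rw [show j + 1 + 2 = (j + 1) + 2 from rfl, tower, show j + 1 + 1 = j + 2 from rfl, ih, natTower,
      Real.rpow_natCast]
    push_cast
    rfl

/-- The number of blocks is linear in `a`, and their size does not depend on `a`. -/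
theorem exists_hasBlockColoring (j : ℕ) : ∃ A b : ℕ, 0 < A ∧ j + 2 ≤ 2 * b ∧ ∀ a, 1 ≤ a →
    ∃ n, 2 ≤ n ∧ n ≤ A * a ∧ HasBlockColoring 4 (j + 2) b n (natTower a j) := by
  match j with
  | 0 => exact ⟨6, 1, by norm_num, by norm_num, fun a ha => ⟨4 * a + 2, by omega, by omega,
      (hasBlockColoring_pairs ha).mono_colors (by norm_num) (by omega) (by norm_num)⟩⟩
  | 1 => exact ⟨6, 2, by norm_num, by norm_num, fun a ha => ⟨4 * a + 2, by omega, by omega,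
      (hasBlockColoring_pairs ha).step_pairs⟩⟩
  | j + 2 =>
    obtain ⟨A, b, hA, hb, h⟩ := exists_hasBlockColoring (j + 1)
    refine ⟨2 * A, 2 ^ (2 * ((j + 3) + b + 2)), by omega, ?_, fun a ha => ?_⟩
    · have h1 : 2 * ((j + 3) + b + 2) < 2 ^ (2 * ((j + 3) + b + 2)) := Nat.lt_two_pow_self
      omega
    · obtain ⟨n, hn, hnA, hcol⟩ := h a ha
      exact ⟨2 * n, by omega, by rw [mul_assoc]; omega, hcol.step (by omega)⟩

/-! ### Finite Ramsey theorem -/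

/-- The finite Ramsey theorem for `k`-sets. -/
theorem exists_forall_monochromatic_subset (q k : ℕ) : ∀ s : ℕ, ∃ N : ℕ, ∀ (ι : Type)
    [LinearOrder ι] (X : Finset ι) (χ : Finset ι → Fin q), N ≤ X.card →
    ∃ Y ⊆ X, Y.card = s ∧ ∃ c, ∀ e ⊆ Y, e.card = k → χ e = c := by
  induction k with
  | zero =>
    intro s
    refine ⟨s, fun ι _ X χ hX => ?_⟩
    obtain ⟨Y, hY, hYs⟩ := Finset.exists_subset_card_eq hX
    refine ⟨Y, hY, hYs, χ ∅, fun e _ he => ?_⟩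
    rw [Finset.card_eq_zero.1 he]
  | succ k ih =>
    -- first find a large set in which the color of a `(k + 1)`-set depends only on its minimum
    have hmin : ∀ t : ℕ, ∃ N : ℕ, ∀ (ι : Type) [LinearOrder ι] (X : Finset ι)
        (χ : Finset ι → Fin q), N ≤ X.card → ∃ Y ⊆ X, Y.card = t ∧ ∃ g : ι → Fin q,
          ∀ e ⊆ Y, e.card = k + 1 → ∀ x ∈ e, (∀ y ∈ e, x ≤ y) → χ e = g x := by
      intro t
      induction t with
      | zero =>
        refine ⟨0, fun ι _ X χ _ => ⟨∅, Finset.empty_subset _, rfl, fun _ => χ ∅, ?_⟩⟩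
        intro e he hek
        rw [Finset.subset_empty.1 he] at hek
        simp at hek
      | succ t iht =>
        obtain ⟨N₁, h₁⟩ := iht
        obtain ⟨N₂, h₂⟩ := ih N₁
        refine ⟨N₂ + 1, fun ι _ X χ hX => ?_⟩
        have hne : X.Nonempty := Finset.card_pos.1 (by omega)
        set x := X.min' hne with hx
        have hxX : x ∈ X := X.min'_mem hne
        obtain ⟨Z, hZX, hZ, c, hc⟩ := h₂ ι (X.erase x) (fun e => χ (insert x e))
          (by rw [Finset.card_erase_of_mem hxX]; omega)
        obtain ⟨Y, hYZ, hY, g, hg⟩ := h₁ ι Z χ hZ.ge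
        have hxY : x ∉ Y := fun h => Finset.notMem_erase x X (hZX (hYZ h))
        have hYX : insert x Y ⊆ X :=
          Finset.insert_subset hxX ((hYZ.trans hZX).trans (Finset.erase_subset _ _))
        refine ⟨insert x Y, hYX, by rw [Finset.card_insert_of_notMem hxY, hY],
          Function.update g x c, fun e he hek y hy hle => ?_⟩
        by_cases hxe : x ∈ e
        · have hyx : y = x := le_antisymm (hle x hxe) (X.min'_le y (hYX (he hy)))
          have h3 := hc (e.erase x)
            ((Finset.subset_insert_iff.1 he).trans hYZ)
            (by rw [Finset.card_erase_of_mem hxe]; omega)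
          rw [Finset.insert_erase hxe] at h3
          rw [h3, hyx, Function.update_self]
        · have heY : e ⊆ Y := (Finset.subset_insert_iff_of_notMem hxe).1 he
          have hyx : y ≠ x := by rintro rfl; exact hxe hy
          rw [Function.update_of_ne hyx]
          exact hg e heY hek y hy hle
    intro s
    obtain ⟨N, hN⟩ := hmin (q * s)
    refine ⟨N, fun ι _ X χ hX => ?_⟩
    obtain ⟨Y, hYX, hY, g, hg⟩ := hN ι X χ hX
    obtain ⟨c, -, hc⟩ := Finset.exists_le_card_fiber_of_mul_le_card_of_maps_to
      (s := Y) (t := (Finset.univ : Finset (Fin q))) (f := g) (n := s)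
      (fun _ _ => Finset.mem_univ _) ⟨χ ∅, Finset.mem_univ _⟩ (by simp [hY])
    obtain ⟨Z, hZ, hZs⟩ := Finset.exists_subset_card_eq hc
    have hZY : Z ⊆ Y := hZ.trans (Finset.filter_subset _ _)
    refine ⟨Z, hZY.trans hYX, hZs, c, fun e he hek => ?_⟩
    have hne : e.Nonempty := Finset.card_pos.1 (by omega)
    rw [hg e (he.trans hZY) hek _ (e.min'_mem hne) fun y hy => e.min'_le y hy]
    exact (Finset.mem_filter.1 (hZ (he (e.min'_mem hne)))).2

/-! ### Hypergraphs given by their edges -/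

/-- The hypergraph with edge set `E` whose vertices are the elements of the edges. -/
def hypergraphOfEdges (E : Finset (Finset ℕ)) : Hypergraph ℕ where
  vertexSet := {v | ∃ e ∈ E, v ∈ e}
  edgeSet := (fun e : Finset ℕ => (e : Set ℕ)) '' (E : Set (Finset ℕ))
  subset_vertexSet_of_mem_edgeSet' := by
    rintro _ ⟨e, he, rfl⟩ v hv
    exact ⟨e, he, hv⟩

section hypergraphOfEdges

variable {E : Finset (Finset ℕ)} {k : ℕ}

theorem isUniform_hypergraphOfEdges (hE : ∀ e ∈ E, e.card = k) :
    (hypergraphOfEdges E).IsUniform k := by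
  rintro _ ⟨e, he, rfl⟩
  simp only [Set.encard_coe_eq_coe_finsetCard, hE e he]

theorem encard_edgeSet_hypergraphOfEdges : (hypergraphOfEdges E).edgeSet.encard = E.card := by
  rw [hypergraphOfEdges, Function.Injective.encard_image Finset.coe_injective,
    Set.encard_coe_eq_coe_finsetCard]

theorem noIsolated_hypergraphOfEdges : (hypergraphOfEdges E).NoIsolated := by
  rintro v ⟨e, he, hv⟩ h
  exact h e ⟨e, he, rfl⟩ hv

theorem encard_image_edge {α β : Type*} {V e : Set α} (he : e ⊆ V) {f : V → β}
    (hf : Function.Injective f) : {y : β | ∃ v : V, (v : α) ∈ e ∧ f v = y}.encard = e.encard := by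
  have h : {y : β | ∃ v : V, (v : α) ∈ e ∧ f v = y} = f '' (Subtype.val ⁻¹' e) := rfl
  rw [h, hf.encard_image,
    Set.encard_preimage_of_injective_subset_range Subtype.val_injective (by simpa using he)]

open Classical in
/-- The Ramsey number is the minimum of a nonempty set, not the junk value `sInf ∅ = 0`. -/
theorem ramseyNumber_hypergraphOfEdges_mem (hE : ∀ e ∈ E, e.card = k) :
    (hypergraphOfEdges E).ramseyNumber k 4 ∈ {N : ℕ | ∀ χ : (completeUniform k N).edgeSet → Fin 4,
      (hypergraphOfEdges E).HasMonochromaticCopy (completeUniform k N) χ} := by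
  apply Nat.sInf_mem
  set V := E.biUnion id with hV
  obtain ⟨N, hN⟩ := exists_forall_monochromatic_subset 4 k V.card
  refine ⟨N, fun χ => ?_⟩
  obtain ⟨Y, -, hY, c, hc⟩ := hN (Fin N) Finset.univ
    (fun e => if h : (e : Set (Fin N)).encard = k then χ ⟨e, h⟩ else 0) (by simp)
  have hmem : ∀ v : (hypergraphOfEdges E).vertexSet, (v : ℕ) ∈ V := by
    rintro ⟨v, e, he, hv⟩
    exact Finset.mem_biUnion.2 ⟨e, he, hv⟩
  set g : V ≃ Y := Finset.equivOfCardEq hY.symm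
  set f : (hypergraphOfEdges E).vertexSet → Fin N := fun v => (g ⟨v, hmem v⟩ : Fin N) with hf
  have hfinj : Function.Injective f := by
    intro v w hvw
    have := g.injective (Subtype.ext hvw)
    exact Subtype.ext (congrArg (fun x : V => (x : ℕ)) this)
  refine ⟨⟨fun v => ⟨f v, Set.mem_univ _⟩, fun v w hvw => hfinj ?_⟩, c, ?_⟩
  · exact congrArg (fun y : (completeUniform k N).vertexSet => (y : Fin N)) hvw
  rintro _ ⟨e, he, rfl⟩
  have hcard : {y : Fin N | ∃ v : (hypergraphOfEdges E).vertexSet,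
      (v : ℕ) ∈ (e : Set ℕ) ∧ f v = y}.encard = k := by
    have hsub : (e : Set ℕ) ⊆ (hypergraphOfEdges E).vertexSet := fun v hv => ⟨e, he, hv⟩
    rw [encard_image_edge hsub hfinj, Set.encard_coe_eq_coe_finsetCard, hE e he]
  refine ⟨hcard, ?_⟩
  set S := {y : Fin N | ∃ v : (hypergraphOfEdges E).vertexSet, (v : ℕ) ∈ (e : Set ℕ) ∧ f v = y}
  have h1 := hc S.toFinset (by
    intro y hy
    obtain ⟨v, -, rfl⟩ := Set.mem_toFinset.1 hy
    exact (g ⟨v, hmem v⟩).2) (by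
    have : ((S.toFinset.card : ℕ) : ℕ∞) = k := by
      rw [← Set.encard_coe_eq_coe_finsetCard, Set.coe_toFinset]; exact hcard
    exact_mod_cast this)
  have h2 : (S.toFinset : Set (Fin N)).encard = k := by rw [Set.coe_toFinset]; exact hcard
  rw [dif_pos h2] at h1
  rw [← h1]
  congr 2
  exact (Set.coe_toFinset S).symm

open Classical in
/-- A coloring without monochromatic block families bounds from below the Ramsey number of any
hypergraph that contains the edges within the unions of two of `n` blocks. -/
theorem lt_ramseyNumber_of_hasBlockColoring {b n M : ℕ} (hk : 1 ≤ k) (hkb : k ≤ 2 * b) (hn : 2 ≤ n)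
    (h : HasBlockColoring 4 k b n M) (hE : ∀ e ∈ E, e.card = k) {D : Fin n → Finset ℕ}
    (hDb : ∀ i, (D i).card = b) (hD : ∀ i j, i ≠ j → Disjoint (D i) (D j))
    (hDE : ∀ i j, i ≠ j → (D i ∪ D j).powersetCard k ⊆ E) :
    M < (hypergraphOfEdges E).ramseyNumber k 4 := by
  by_contra! hle
  obtain ⟨φ, hφ⟩ := h
  obtain ⟨f, c, hc⟩ := ramseyNumber_hypergraphOfEdges_mem hE
    fun e => φ ((Set.toFinset e.1).image Fin.val)
  have hDV : ∀ i, ∀ v ∈ D i, v ∈ (hypergraphOfEdges E).vertexSet := by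
    intro i v hv
    have : Nontrivial (Fin n) := Fin.nontrivial_iff_two_le.2 hn
    obtain ⟨j, hj⟩ := exists_ne i
    obtain ⟨e, hve, he, hek⟩ := Finset.exists_subsuperset_card_eq (s := {v}) (t := D i ∪ D j)
      (n := k) (Finset.singleton_subset_iff.2 (Finset.mem_union_left _ hv)) (by simpa using hk)
      (by rw [Finset.card_union_of_disjoint (hD i j hj.symm), hDb, hDb]; omega)
    exact ⟨e, hDE i j hj.symm (Finset.mem_powersetCard.2 ⟨he, hek⟩), hve (by simp)⟩
  set g : ℕ → ℕ := fun v => if hv : v ∈ (hypergraphOfEdges E).vertexSet then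
    ((f ⟨v, hv⟩).1 : ℕ) else 0 with hg
  have hgv : ∀ v : (hypergraphOfEdges E).vertexSet, g v = ((f v).1 : ℕ) := fun v => by
    simp only [hg, v.2, dif_pos]
  have hginj : Set.InjOn g (hypergraphOfEdges E).vertexSet := by
    intro v hv w hw hvw
    rw [hgv ⟨v, hv⟩, hgv ⟨w, hw⟩] at hvw
    exact congrArg Subtype.val (f.injective (Subtype.ext (Fin.ext hvw)))
  refine hφ (fun i => (D i).image g) ⟨fun i => ?_, fun i x hx => ?_, fun i j hij => ?_⟩ c
    fun i j hij e he hek => ?_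
  · rw [Finset.card_image_of_injOn (hginj.mono fun v hv => hDV i v hv), hDb]
  · obtain ⟨v, hv, rfl⟩ := Finset.mem_image.1 hx
    rw [hgv ⟨v, hDV i v hv⟩]
    exact (f ⟨v, hDV i v hv⟩).1.2.trans_le hle
  · rw [Finset.disjoint_left]
    intro x hx hx'
    obtain ⟨v, hv, rfl⟩ := Finset.mem_image.1 hx
    obtain ⟨w, hw, hwv⟩ := Finset.mem_image.1 hx'
    have := hginj (hDV j w hw) (hDV i v hv) hwv
    exact Finset.disjoint_left.1 (hD i j hij) hv (this ▸ hw)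
  · rw [← Finset.image_union, Finset.subset_image_iff] at he
    obtain ⟨e₀, he₀, rfl⟩ := he
    have he₀V : ∀ v ∈ e₀, v ∈ (hypergraphOfEdges E).vertexSet := fun v hv =>
      (Finset.mem_union.1 (he₀ hv)).elim (hDV i v) (hDV j v)
    rw [Finset.card_image_of_injOn (hginj.mono fun v hv => he₀V v hv)] at hek
    obtain ⟨hmem, hcol⟩ := hc e₀ ⟨e₀, hDE i j hij (Finset.mem_powersetCard.2 ⟨he₀, hek⟩), rfl⟩
    rw [← hcol]
    congr 1
    ext x
    simp only [Finset.mem_image, Set.mem_toFinset, Set.mem_ofPred_eq]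
    constructor
    · rintro ⟨v, hv, rfl⟩
      exact ⟨_, ⟨⟨v, he₀V v hv⟩, hv, rfl⟩, (hgv ⟨v, he₀V v hv⟩).symm⟩
    · rintro ⟨y, ⟨v, hv, rfl⟩, rfl⟩
      exact ⟨v, hv, hgv v⟩

end hypergraphOfEdges

theorem exists_superset_of_card_sets {k m : ℕ} (hk : 1 ≤ k) {E : Finset (Finset ℕ)}
    (hE : ∀ e ∈ E, e.card = k) (hm : E.card ≤ m) :
    ∃ E', E ⊆ E' ∧ E'.card = m ∧ ∀ e ∈ E', e.card = k := by
  have hinf : Infinite {e : Finset ℕ // e.card = k} := by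
    refine Infinite.of_injective (fun i : ℕ => ⟨Finset.Ico i (i + k), by simp⟩) fun i j hij => ?_
    have h : Finset.Ico i (i + k) = Finset.Ico j (j + k) := congrArg Subtype.val hij
    have h1 : i ∈ Finset.Ico j (j + k) := h ▸ Finset.mem_Ico.2 ⟨le_rfl, by omega⟩
    have h2 : j ∈ Finset.Ico i (i + k) := h ▸ Finset.mem_Ico.2 ⟨le_rfl, by omega⟩
    rw [Finset.mem_Ico] at h1 h2
    omega
  obtain ⟨t, ht, htm⟩ := Infinite.exists_superset_card_eq
    (E.subtype fun e => e.card = k) m (by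
      rw [Finset.card_subtype]; exact (Finset.card_filter_le _ _).trans hm)
  refine ⟨t.map (Function.Embedding.subtype _), fun e he => ?_, by rw [Finset.card_map, htm],
    fun e he => ?_⟩
  · exact Finset.mem_map.2 ⟨⟨e, hE e he⟩, ht (Finset.mem_subtype.2 he), rfl⟩
  · obtain ⟨⟨e, he'⟩, -, rfl⟩ := Finset.mem_map.1 he
    exact he'

/-- The edges within the unions of two of `n` blocks, together with arbitrary further edges that
bring their number to `m`. -/
theorem exists_hypergraph_of_hasBlockColoring {k b n M m : ℕ} (hk : 1 ≤ k) (hkb : k ≤ 2 * b)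
    (hn : 2 ≤ n) (h : HasBlockColoring 4 k b n M) (hm : n * n * 2 ^ (2 * b) ≤ m) :
    ∃ H : Hypergraph ℕ, H.IsUniform k ∧ H.edgeSet.encard = (m : ℕ∞) ∧ H.NoIsolated ∧
      M ≤ H.ramseyNumber k 4 := by
  set D : Fin n → Finset ℕ := fun i => Finset.Ico (b * i) (b * i + b) with hD
  have hDb : ∀ i, (D i).card = b := fun i => by simp [hD]
  have hdisj : ∀ i j, i ≠ j → Disjoint (D i) (D j) := by
    intro i j hij
    rw [Finset.disjoint_left]
    intro x hx hy
    simp only [hD, Finset.mem_Ico] at hx hy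
    rcases lt_or_gt_of_ne (fun h => hij (Fin.ext h) : (i : ℕ) ≠ j) with h1 | h1
    · have := Nat.mul_le_mul_left b (Nat.succ_le_of_lt h1)
      rw [Nat.mul_succ] at this
      omega
    · have := Nat.mul_le_mul_left b (Nat.succ_le_of_lt h1)
      rw [Nat.mul_succ] at this
      omega
  set E₀ := (Finset.univ : Finset (Fin n × Fin n)).biUnion fun p =>
    (D p.1 ∪ D p.2).powersetCard k with hE₀
  have hE₀k : ∀ e ∈ E₀, e.card = k := by
    intro e he
    obtain ⟨p, -, hp⟩ := Finset.mem_biUnion.1 he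
    exact (Finset.mem_powersetCard.1 hp).2
  have hE₀m : E₀.card ≤ m := by
    refine (Finset.card_biUnion_le_card_mul _ _ (2 ^ (2 * b)) fun p _ => ?_).trans
      (by simpa using hm)
    rw [Finset.card_powersetCard]
    refine (Nat.choose_le_two_pow _ _).trans (Nat.pow_le_pow_right (by norm_num) ?_)
    refine (Finset.card_union_le _ _).trans ?_
    rw [hDb, hDb]
    omega
  obtain ⟨E, hE, hEm, hEk⟩ := exists_superset_of_card_sets hk hE₀k hE₀m
  refine ⟨hypergraphOfEdges E, isUniform_hypergraphOfEdges hEk,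
    by rw [encard_edgeSet_hypergraphOfEdges, hEm], noIsolated_hypergraphOfEdges,
    (lt_ramseyNumber_of_hasBlockColoring hk hkb hn h hEk hDb hdisj fun i j _ => ?_).le⟩
  exact (Finset.subset_biUnion_of_mem (fun p : Fin n × Fin n => (D p.1 ∪ D p.2).powersetCard k)
    (Finset.mem_univ (i, j))).trans hE

/-- The perfect matching with `m` edges needs `k * m` vertices. -/
theorem exists_matching {k : ℕ} (hk : 1 ≤ k) (m : ℕ) :
    ∃ H : Hypergraph ℕ, H.IsUniform k ∧ H.edgeSet.encard = (m : ℕ∞) ∧ H.NoIsolated ∧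
      k * m ≤ H.ramseyNumber k 4 := by
  set E := (Finset.range m).image fun i => Finset.Ico (k * i) (k * i + k) with hE
  have hEk : ∀ e ∈ E, e.card = k := by
    intro e he
    obtain ⟨i, -, rfl⟩ := Finset.mem_image.1 he
    simp
  have hEm : E.card = m := by
    rw [hE, Finset.card_image_of_injective, Finset.card_range]
    intro i j hij
    simp only at hij
    have h1 : k * i ∈ Finset.Ico (k * j) (k * j + k) := hij ▸ Finset.mem_Ico.2 ⟨le_rfl, by omega⟩
    have h2 : k * j ∈ Finset.Ico (k * i) (k * i + k) := hij ▸ Finset.mem_Ico.2 ⟨le_rfl, by omega⟩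
    rw [Finset.mem_Ico] at h1 h2
    exact Nat.eq_of_mul_eq_mul_left (by omega : 0 < k) (by omega)
  refine ⟨hypergraphOfEdges E, isUniform_hypergraphOfEdges hEk,
    by rw [encard_edgeSet_hypergraphOfEdges, hEm], noIsolated_hypergraphOfEdges, ?_⟩
  obtain ⟨f, -, -⟩ := ramseyNumber_hypergraphOfEdges_mem hEk fun _ => 0
  have hmem : ∀ x : Fin (k * m), (x : ℕ) ∈ (hypergraphOfEdges E).vertexSet := by
    intro x
    refine ⟨_, Finset.mem_image_of_mem _ (Finset.mem_range.2 (Nat.div_lt_of_lt_mul x.2)), ?_⟩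
    have h1 := Nat.div_add_mod (x : ℕ) k
    have h2 := Nat.mod_lt (x : ℕ) (by omega : k > 0)
    rw [Finset.mem_Ico]
    omega
  have hinj : Function.Injective fun x : Fin (k * m) =>
      (f ⟨x, hmem x⟩ : Fin ((hypergraphOfEdges E).ramseyNumber k 4)) := by
    intro x y hxy
    have := f.injective (Subtype.ext hxy)
    exact Fin.ext (congrArg Subtype.val this)
  simpa using Fintype.card_le_of_injective _ hinj

/-! ### The tower function and the choice of the constant -/

theorem continuous_tower : ∀ k, Continuous (tower k)
  | 0 => continuous_id
  | 1 => continuous_id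
  | k + 2 => by
    have h := continuous_tower (k + 1)
    exact Continuous.rpow continuous_const h fun _ => Or.inl (by norm_num)

theorem tower_mono : ∀ k, Monotone (tower k)
  | 0 => monotone_id
  | 1 => monotone_id
  | k + 2 => fun _ _ h =>
    Real.rpow_le_rpow_of_exponent_le (by norm_num) (tower_mono (k + 1) h)

open Filter Topology in
/-- The condition `tower k 0 < k * m` leaves room for a positive constant at each `m`. -/
theorem eventually_tower_le (k C : ℕ) : ∀ᶠ c in 𝓝[>] (0 : ℝ), ∀ m ∈ Finset.range C,
    tower k 0 < (k : ℝ) * (m : ℝ) → tower k (c * Real.sqrt m) ≤ (k : ℝ) * (m : ℝ) := by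
  refine (Filter.eventually_all_finset _).2 fun m _ => ?_
  by_cases hm : tower k 0 < (k : ℝ) * (m : ℝ)
  · have hcont : Continuous fun c : ℝ => tower k (c * Real.sqrt m) :=
      (continuous_tower k).comp (continuous_id.mul continuous_const)
    have h0 : tower k ((0 : ℝ) * Real.sqrt m) < (k : ℝ) * (m : ℝ) := by rwa [zero_mul]
    have h1 := (hcont.tendsto 0).eventually (gt_mem_nhds h0)
    exact (h1.filter_mono nhdsWithin_le_nhds).mono fun c hc _ => hc.le
  · exact Filter.Eventually.of_forall fun c h => absurd h hm

theorem exists_sq_le_and_sqrt_le {C m : ℕ} (hC : 0 < C) (hm : C ≤ m) :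
    ∃ a, 1 ≤ a ∧ C * (a * a) ≤ m ∧ Real.sqrt m ≤ 2 * C * a := by
  set a := Nat.sqrt (m / C) with ha
  have h1 : 1 ≤ a := Nat.le_sqrt'.2 (by simpa using (Nat.one_le_div_iff hC).2 hm)
  have h2 : C * (a * a) ≤ m :=
    (Nat.mul_le_mul_left C (Nat.sqrt_le (m / C))).trans (Nat.mul_div_le m C)
  have h3 : m < C * ((a + 1) * (a + 1)) := by
    have := Nat.lt_mul_div_succ m hC
    exact this.trans_le (Nat.mul_le_mul_left C (Nat.lt_succ_sqrt (m / C)))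
  refine ⟨a, h1, h2, Real.sqrt_le_iff.2 ⟨by positivity, ?_⟩⟩
  have h4 : m ≤ (2 * C * a) ^ 2 := by
    calc m ≤ C * ((a + 1) * (a + 1)) := h3.le
      _ ≤ C * ((2 * a) * (2 * a)) := by gcongr <;> omega
      _ ≤ (C * C) * ((2 * a) * (2 * a)) := Nat.mul_le_mul_right _ (Nat.le_mul_self C)
      _ = (2 * C * a) ^ 2 := by ring
  exact_mod_cast h4

open Filter Topology in
/-- The condition `tower k 0 < k * m` holds for all `m ≥ 1` if `k ≤ 3`, and for all but finitely
many `m` for every `k`. -/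
theorem theorem1p3 (k : ℕ) (hk : 2 ≤ k) :
    ∃ c : ℝ, 0 < c ∧ ∀ m : ℕ, 0 < m → tower k 0 < (k : ℝ) * (m : ℝ) →
      ∃ (V : Type) (H : Hypergraph V),
        H.IsUniform k ∧ H.edgeSet.encard = (m : ℕ∞) ∧ H.NoIsolated ∧
          tower k (c * Real.sqrt (m : ℝ)) ≤ (H.ramseyNumber k 4 : ℝ) := by
  obtain ⟨j, rfl⟩ := Nat.exists_eq_add_of_le' hk
  obtain ⟨A, b, hA, hb, hcol⟩ := exists_hasBlockColoring j
  set C := A * A * 2 ^ (2 * b) with hC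
  have hCpos : 0 < C := by positivity
  have hc₀ : (0 : ℝ) < 1 / (2 * C) := by positivity
  obtain ⟨c, hsmall, hc₁, hc⟩ := ((eventually_tower_le (j + 2) C).and
    (((gt_mem_nhds hc₀).filter_mono nhdsWithin_le_nhds).and self_mem_nhdsWithin)).exists
  refine ⟨c, hc, fun m _ hm => ⟨ℕ, ?_⟩⟩
  rcases lt_or_ge m C with hmC | hmC
  · obtain ⟨H, h1, h2, h3, h4⟩ := exists_matching (k := j + 2) (by omega) m
    refine ⟨H, h1, h2, h3, (hsmall m (Finset.mem_range.2 hmC) hm).trans ?_⟩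
    exact_mod_cast h4
  · obtain ⟨a, ha, hCa, hsqrt⟩ := exists_sq_le_and_sqrt_le hCpos hmC
    obtain ⟨n, hn, hnA, h⟩ := hcol a ha
    obtain ⟨H, h1, h2, h3, h4⟩ := exists_hypergraph_of_hasBlockColoring (m := m) (by omega) hb hn h
      (by
        calc n * n * 2 ^ (2 * b) ≤ (A * a) * (A * a) * 2 ^ (2 * b) := by gcongr
          _ = C * (a * a) := by rw [hC]; ring
          _ ≤ m := hCa)
    refine ⟨H, h1, h2, h3, ?_⟩
    have hca : c * Real.sqrt m ≤ a := by
      calc c * Real.sqrt m ≤ 1 / (2 * C) * (2 * C * a) := by gcongr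
        _ = a := by field_simp
    calc tower (j + 2) (c * Real.sqrt m) ≤ tower (j + 2) a := tower_mono _ hca
      _ = natTower a j := tower_natCast a j
      _ ≤ _ := by exact_mod_cast h4
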